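/- Let $X_H=[0,1)$ with Lebesgue measure $\mu_H$, and let $T_H$ be the triadic von Neumann--Kakutani map, built by cutting and stacking: tower $0$ has the single level $[0,1)$; tower $n+1$ is obtained from tower $n$ (which has $3^n$ levels, each an interval of length $3^{-n}$) by cutting every level into three intervals of equal length and stacking the three resulting columns from left to right; and $T_H$ translates each level of a tower other than the top one onto the level just above it. Let $Y=\{-1,1\}^{\mathbb N}$, with $\mathbb N=\{0,1,2,\dots\}$, carry the product $\nu$ of the uniform probabilities on $\{-1,1\}$. For $n\ge 1$ let $\tau_n:Y\to Y$ replace the first $2^n$ coordinates $w_1w_2$ of $y$ (where $w_1,w_2$ are words of length $2^{n-1}$) by $w_2\,(w_1\cdot w_2)$, where $w_1\cdot w_2$ is the termwise product, and leave the other coordinates unchanged. For $x\in X_H$ let $n(x)$ be the smallest $n\ge 1$ such that $x$ is not in the top level of tower $n$, and let $S_x=\tau_{n(x)}\circ\tau_{n(x)-1}\circ\cdots\circ\tau_1$. On $X=X_H\times Y$ with its Borel $\sigma$-algebra $\mathscr A$ and $\mu=\mu_H\otimes\nu$ let $T(x,y)=(T_Hx,S_xy)$, and let $\mathscr H=\{E\times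 Y: E\subseteq X_H\text{ Borel}\}$. Theorem. $T_H$ is an ergodic automorphism of $(X_H,\mu_H)$, every $S_x$ is an automorphism of $(Y,\nu)$, $T$ is an ergodic automorphism of the Lebesgue probability space $(X,\mathscr A,\mu)$, and $\mathscr H$ is a factor of $T$, that is, a sub-$\sigma$-algebra of $\mathscr A$ with $T^{-1}\mathscr H=\mathscr H$ (automorphisms are invertible up to null sets). Moreover: (a) $T$ is $\mathscr H$-relatively twofold mixing: for all $A,B\in\mathscr A$, $$\mu(A\cap T^{-k}B\mid\mathscr H)-\mu(A\mid\mathscr H)\,\mu(T^{-k}B\mid\mathscr H)\to 0\quad\text{in probability as }k\to\infty .$$ (b) $T$ is not $\mathscr H$-relatively threefold mixing: it is not true that for all $A,B,C\in\mathscr A$, $$\mu(A\cap T^{-j}B\cap T^{-k}C\mid\mathscr H)-\mu(A\mid\mathscr H)\,\mu(T^{-j}B\mid\mathscr H)\,\mu(T^{-k}C\mid\mathscr H)\to 0\quad\text{in probability as }j\to\infty\text{ and }k-j\to\infty .$$ (c) The failure in (b) is witnessed by $A=B=C=\{(x,y):y_0=1\}$. Indeed $\mu(T^{-k}A\mid\mathscr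 H)=1/2$ almost surely for every $k\ge 0$, so that the product of three such conditional measures is $1/8$; but for every $n\ge 1$ and almost every $(x,y)$ such that $x$ lies in the first of the three columns of tower $n$ (that is, in one of the lowest $3^n$ levels of tower $n+1$), $$\mu(A\cap T^{-3^n}A\cap T^{-2\cdot 3^n}A\mid\mathscr H)(x,y)=1/4 .$$ -/

import Mathlib

open MeasureTheory ProbabilityTheory Filter
open scoped ENNReal

noncomputable section

/-! General notions: automorphisms, factors, relative mixing. -/

/-- `T` is an automorphism of the probability space `(X, μ)`: it preserves `μ` and, up to null sets,
it has a measure-preserving inverse. -/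
def IsAutomorphism {X : Type*} [MeasurableSpace X] (μ : Measure X) (T : X → X) : Prop :=
  MeasurePreserving T μ μ ∧
    ∃ S : X → X, MeasurePreserving S μ μ ∧ (∀ᵐ x ∂μ, S (T x) = x) ∧ (∀ᵐ x ∂μ, T (S x) = x)

/-- A factor: a sub-σ-algebra `H` with `T⁻¹ H = H`. -/
def IsFactor {X : Type*} [mX : MeasurableSpace X] (T : X → X) (H : MeasurableSpace X) : Prop :=
  H ≤ mX ∧ MeasurableSpace.comap T H = H

/-- `μ(A ∩ T⁻ᵏB | H) - μ(A | H) μ(T⁻ᵏB | H) → 0` in probability as `k → ∞`, for all measurable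
`A`, `B`. -/
def RelTwofoldMixing {X : Type*} [mX : MeasurableSpace X] (μ : Measure X) (T : X → X)
    (H : MeasurableSpace X) : Prop :=
  ∀ A B : Set X, MeasurableSet[mX] A → MeasurableSet[mX] B →
    TendstoInMeasure μ
      (fun (k : ℕ) (x : X) =>
        (μ⟦A ∩ T^[k] ⁻¹' B | H⟧) x - (μ⟦A | H⟧) x * (μ⟦T^[k] ⁻¹' B | H⟧) x)
      atTop (fun _ => (0 : ℝ))

/-- `μ(A ∩ T⁻ʲB ∩ T⁻ᵏC | H) - μ(A | H) μ(T⁻ʲB | H) μ(T⁻ᵏC | H) → 0` in probability as both `j` and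
`l = k - j` tend to infinity, for all measurable `A`, `B`, `C`; the index is the pair `(j, l)`. -/
def RelThreefoldMixing {X : Type*} [mX : MeasurableSpace X] (μ : Measure X) (T : X → X)
    (H : MeasurableSpace X) : Prop :=
  ∀ A B C : Set X, MeasurableSet[mX] A → MeasurableSet[mX] B → MeasurableSet[mX] C →
    TendstoInMeasure μ
      (fun (p : ℕ × ℕ) (x : X) =>
        (μ⟦A ∩ T^[p.1] ⁻¹' B ∩ T^[p.1 + p.2] ⁻¹' C | H⟧) x
          - (μ⟦A | H⟧) x * (μ⟦T^[p.1] ⁻¹' B | H⟧) x * (μ⟦T^[p.1 + p.2] ⁻¹' C | H⟧) x)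
      (atTop ×ˢ atTop) (fun _ => (0 : ℝ))

namespace TriadicSkew

/-! The base: the triadic von Neumann–Kakutani map, by cutting and stacking. -/

/-- The space `[0, 1)`. -/
abbrev Base : Type := Set.Ico (0 : ℝ) 1

/-- Lebesgue measure on `[0, 1)`. -/
def baseMeasure : Measure Base := Measure.comap Subtype.val volume

/-- Left end point of level `k` (`0 ≤ k < 3 ^ n`) of the `n`-th tower. The towers are built
recursively: tower `0` has the single level `[0, 1)`; each level of tower `n` is cut into three
intervals of the same length, and the three resulting columns are stacked from left to right, so
that level `c * 3 ^ n + i` of tower `n + 1` is the `c`-th third of level `i` of tower `n`. -/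
def levelLeft : ℕ → ℕ → ℝ
  | 0, _ => 0
  | n + 1, k => levelLeft n (k % 3 ^ n) + ((k / 3 ^ n : ℕ) : ℝ) * (1 / 3 : ℝ) ^ (n + 1)

/-- Level `k` of the `n`-th tower, an interval of length `3 ^ (-n)`. -/
def level (n k : ℕ) : Set Base :=
  {x | levelLeft n k ≤ (x : ℝ) ∧ (x : ℝ) < levelLeft n k + (1 / 3 : ℝ) ^ n}

/-- The top level of the `n`-th tower. -/
def top (n : ℕ) : Set Base := level n (3 ^ n - 1)

/-- The first of the three columns of the `n`-th tower: the lowest `3 ^ n` levels of tower `n + 1`. -/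
def firstColumn (n : ℕ) : Set Base := ⋃ i ∈ Finset.range (3 ^ n), level (n + 1) i

theorem levelLeft_bounds (n : ℕ) : ∀ k < 3 ^ n,
    0 ≤ levelLeft n k ∧ levelLeft n k + (1 / 3 : ℝ) ^ n ≤ 1 := by
  induction n with
  | zero => intro k _; simp [levelLeft]
  | succ n ih =>
    intro k hk
    obtain ⟨h0, h1⟩ := ih (k % 3 ^ n) (Nat.mod_lt _ (by positivity))
    have hq : k / 3 ^ n < 3 := by
      rw [Nat.div_lt_iff_lt_mul (by positivity)]
      rw [pow_succ] at hk
      omega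
    have hq' : ((k / 3 ^ n : ℕ) : ℝ) ≤ 2 := by exact_mod_cast Nat.le_of_lt_succ hq
    have hp : (0 : ℝ) < (1 / 3 : ℝ) ^ (n + 1) := by positivity
    have hpe : (1 / 3 : ℝ) ^ n = 3 * (1 / 3 : ℝ) ^ (n + 1) := by rw [pow_succ]; ring
    simp only [levelLeft]
    refine ⟨by positivity, ?_⟩
    rw [hpe] at h1
    nlinarith

theorem exists_level (n : ℕ) (x : Base) : ∃ k, k < 3 ^ n ∧ x ∈ level n k := by
  induction n with
  | zero => exact ⟨0, by simp, by simpa [levelLeft] using x.2.1, by simpa [levelLeft] using x.2.2⟩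
  | succ n ih =>
    obtain ⟨i, hi, hl, hr⟩ := ih
    have hp : (0 : ℝ) < (1 / 3 : ℝ) ^ (n + 1) := by positivity
    have hpe : (1 / 3 : ℝ) ^ n = 3 * (1 / 3 : ℝ) ^ (n + 1) := by rw [pow_succ]; ring
    rw [hpe] at hr
    have key : ∀ c : ℕ, c < 3 → levelLeft n i + c * (1 / 3 : ℝ) ^ (n + 1) ≤ (x : ℝ) →
        (x : ℝ) < levelLeft n i + (c + 1) * (1 / 3 : ℝ) ^ (n + 1) →
        ∃ k, k < 3 ^ (n + 1) ∧ x ∈ level (n + 1) k := by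
      intro c hc h1 h2
      have hm : (c * 3 ^ n + i) % 3 ^ n = i := by
        rw [Nat.mul_add_mod', Nat.mod_eq_of_lt hi]
      have hd : (c * 3 ^ n + i) / 3 ^ n = c := by
        rw [mul_comm, Nat.mul_add_div (by positivity), Nat.div_eq_of_lt hi, add_zero]
      refine ⟨c * 3 ^ n + i, ?_, ?_⟩
      · rw [pow_succ]
        nlinarith
      · simp only [level, levelLeft, Set.mem_ofPred_eq, hm, hd]
        exact ⟨h1, by linarith⟩
    by_cases h1 : (x : ℝ) < levelLeft n i + 1 * (1 / 3 : ℝ) ^ (n + 1)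
    · exact key 0 (by norm_num) (by push_cast; linarith) (by push_cast; linarith)
    by_cases h2 : (x : ℝ) < levelLeft n i + 2 * (1 / 3 : ℝ) ^ (n + 1)
    · exact key 1 (by norm_num) (by push_cast; linarith) (by push_cast; linarith)
    · exact key 2 (by norm_num) (by push_cast; linarith) (by push_cast; linarith)

theorem levelLeft_top (n : ℕ) : levelLeft n (3 ^ n - 1) = 1 - (1 / 3 : ℝ) ^ n := by
  induction n with
  | zero => simp [levelLeft]
  | succ n ih =>
    have hpos : 0 < 3 ^ n := by positivity
    have he : 3 ^ (n + 1) - 1 = 2 * 3 ^ n + (3 ^ n - 1) := by rw [pow_succ]; omega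
    have hm : (2 * 3 ^ n + (3 ^ n - 1)) % 3 ^ n = 3 ^ n - 1 := by
      rw [Nat.mul_add_mod', Nat.mod_eq_of_lt (by omega)]
    have hd : (2 * 3 ^ n + (3 ^ n - 1)) / 3 ^ n = 2 := by
      rw [mul_comm, Nat.mul_add_div hpos, Nat.div_eq_of_lt (by omega), add_zero]
    rw [he, levelLeft, hm, hd, ih, pow_succ]
    push_cast
    ring

theorem exists_not_mem_top (x : Base) : ∃ n, 1 ≤ n ∧ x ∉ top n := by
  obtain ⟨n, hn⟩ := exists_pow_lt_of_lt_one (sub_pos.2 x.2.2) (by norm_num : (1 / 3 : ℝ) < 1)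
  refine ⟨n + 1, by omega, fun h => ?_⟩
  have h1 : levelLeft (n + 1) (3 ^ (n + 1) - 1) ≤ (x : ℝ) := h.1
  rw [levelLeft_top, pow_succ] at h1
  have : (0 : ℝ) < (1 / 3 : ℝ) ^ n := by positivity
  linarith

open Classical in
/-- `n(x)`: the smallest `n ≥ 1` such that `x` is not in the top of tower `n`. -/
def entryStep (x : Base) : ℕ := Nat.find (exists_not_mem_top x)

open Classical in
/-- The index of the level of tower `n` that contains `x`. -/
def levelIndex (n : ℕ) (x : Base) : ℕ := Nat.find (exists_level n x)

/-- The amount of the translation which carries the level of tower `n` that contains `x` onto the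
next level of tower `n`. -/
def shift (n : ℕ) (x : Base) : ℝ :=
  levelLeft n (levelIndex n x + 1) - levelLeft n (levelIndex n x)

theorem add_shift_mem (x : Base) :
    (x : ℝ) + shift (entryStep x) x ∈ Set.Ico (0 : ℝ) 1 := by
  classical
  obtain ⟨_, hn⟩ : 1 ≤ entryStep x ∧ x ∉ top (entryStep x) := Nat.find_spec (exists_not_mem_top x)
  obtain ⟨hk, hl, hr⟩ : levelIndex (entryStep x) x < 3 ^ entryStep x ∧
      x ∈ level (entryStep x) (levelIndex (entryStep x) x) :=
    Nat.find_spec (exists_level (entryStep x) x)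
  have hne : levelIndex (entryStep x) x ≠ 3 ^ entryStep x - 1 := by
    intro h
    exact hn (by rw [top, ← h]; exact ⟨hl, hr⟩)
  obtain ⟨h0, h1⟩ := levelLeft_bounds (entryStep x) (levelIndex (entryStep x) x + 1) (by omega)
  unfold shift
  constructor <;> linarith

/-- The triadic von Neumann–Kakutani map `T_H`: with `n = n(x)`, it carries the level of tower `n`
that contains `x` by a translation onto the next level of tower `n`. -/
def baseMap (x : Base) : Base := ⟨(x : ℝ) + shift (entryStep x) x, add_shift_mem x⟩

/-! The fibre and the Rokhlin cocycle. -/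

/-- The space `{-1, 1} ^ ℕ`; here `ℤˣ = {-1, 1}`. -/
abbrev Fibre : Type := ℕ → ℤˣ

/-- The uniform probability on `{-1, 1}`. -/
def coin : Measure ℤˣ := (PMF.uniformOfFintype ℤˣ).toMeasure

instance : IsProbabilityMeasure coin := by unfold coin; infer_instance

/-- The product measure on `{-1, 1} ^ ℕ` with uniform marginals. -/
def fibreMeasure : Measure Fibre := Measure.infinitePi (fun _ : ℕ => coin)

/-- The map `τ_n` (`n ≥ 1`): if the first `2 ^ n` coordinates of `y` are the word `w₁ w₂`, with `w₁`
and `w₂` of length `2 ^ (n - 1)`, they are replaced by `w₂ (w₁ · w₂)`, where `w₁ · w₂` is the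
termwise product; the other coordinates do not change. -/
def tau (n : ℕ) (y : Fibre) : Fibre := fun i =>
  if i < 2 ^ (n - 1) then y (i + 2 ^ (n - 1))
  else if i < 2 ^ n then y (i - 2 ^ (n - 1)) * y i
  else y i

/-- `τ_n ∘ τ_{n-1} ∘ ⋯ ∘ τ_1`. -/
def tauComp : ℕ → Fibre → Fibre
  | 0 => id
  | n + 1 => tau (n + 1) ∘ tauComp n

/-- The Rokhlin cocycle `S_x = τ_{n(x)} ∘ ⋯ ∘ τ_1`. -/
def cocycle (x : Base) : Fibre → Fibre := tauComp (entryStep x)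

/-! The skew product. -/

/-- The space `[0, 1) × {-1, 1} ^ ℕ`. -/
abbrev Space : Type := Base × Fibre

/-- The product measure. -/
def skewMeasure : Measure Space := baseMeasure.prod fibreMeasure

/-- The skew product `T (x, y) = (T_H x, S_x y)`. -/
def skewMap (p : Space) : Space := (baseMap p.1, cocycle p.1 p.2)

/-- The σ-algebra of the sets `E × {-1, 1} ^ ℕ`, where `E ⊆ [0, 1)` is Borel. -/
abbrev baseFactor : MeasurableSpace Space := MeasurableSpace.comap Prod.fst inferInstance

/-- The event `y_0 = 1`. -/
def zeroCoordOne : Set Space := {p | p.2 0 = 1}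

end TriadicSkew

end

noncomputable section

namespace TriadicSkew

/-! ### Combinatorics of the towers -/

/-! Everything is read from the bottom of a tower. Let `climb n k` be the composition of the cocycle
from level `0` to level `k` of tower `n`. Since `tau (n + 1)` has order three, `tauComp n` undoes
the climb to the top of tower `n` (`tauComp_climb_top`), so crossing from one column to the next
only adds one power of `tau (n + 1)`: on column `c` the climb is the climb of tower `n` after the
`c`-th power of `tau (n + 1)` (`cocycle_climb`). The first `2 ^ n` coordinates of the three powers
are the words `w₁`, `w₂`, `w₁ · w₂`, which are pairwise independent but not independent.

Pairwise independence gives twofold mixing. Two times at distance at least `3 ^ m` lie in different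
copies of tower `m` inside a tall tower; at the tower where their columns separate, two different
powers of `tau` appear, and events on the first `2 ^ m` coordinates are exactly independent
(`fibreMeasure_inter_preimage_iterCocycle`). Correlations of rectangles over cylinders thus vanish
eventually, and a π-system argument in each variable covers all measurable sets
(`tendsto_lintegral_fibreCov`). Ergodicity follows: an invariant set is asymptotically independent
of itself in the fibres, so its fibres have mass `0` or `1`, and the base is ergodic.

The relation between the words defeats threefold mixing. All `climb` maps are multiplicative, so
over the first column of tower `n` the coordinate `y_0` at time `2 * 3 ^ n` is the product of those
at times `0` and `3 ^ n` (`iterCocycle_two_mul_apply_zero`). The triple correlation is then `1/4`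
instead of `1/8`, on a set of mass `1/3` for every `n`. -/

theorem exists_column_index {n k : ℕ} (hk : k < 3 ^ (n + 1)) :
    ∃ c i, c < 3 ∧ i < 3 ^ n ∧ k = c * 3 ^ n + i := by
  refine ⟨k / 3 ^ n, k % 3 ^ n, ?_, Nat.mod_lt _ (by positivity), ?_⟩
  · rw [Nat.div_lt_iff_lt_mul (by positivity)]
    rw [pow_succ] at hk
    omega
  · rw [mul_comm]
    exact (Nat.div_add_mod _ _).symm

theorem column_mod {n c i : ℕ} (hi : i < 3 ^ n) : (c * 3 ^ n + i) % 3 ^ n = i := by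
  rw [Nat.mul_add_mod', Nat.mod_eq_of_lt hi]

theorem column_div {n c i : ℕ} (hi : i < 3 ^ n) : (c * 3 ^ n + i) / 3 ^ n = c := by
  rw [mul_comm, Nat.mul_add_div (by positivity), Nat.div_eq_of_lt hi, add_zero]

theorem levelLeft_column {n c i : ℕ} (hi : i < 3 ^ n) :
    levelLeft (n + 1) (c * 3 ^ n + i) = levelLeft n i + c * (1 / 3 : ℝ) ^ (n + 1) := by
  rw [levelLeft, column_mod hi, column_div hi]

theorem third_pow (n : ℕ) : (1 / 3 : ℝ) ^ n = 3 * (1 / 3 : ℝ) ^ (n + 1) := by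
  rw [pow_succ]
  ring

theorem level_column_subset {n c i : ℕ} (hc : c < 3) (hi : i < 3 ^ n) :
    level (n + 1) (c * 3 ^ n + i) ⊆ level n i := by
  intro x hx
  obtain ⟨h1, h2⟩ := hx
  rw [levelLeft_column hi] at h1 h2
  have hp : (0 : ℝ) < (1 / 3 : ℝ) ^ (n + 1) := by positivity
  have hc' : (c : ℝ) ≤ 2 := by exact_mod_cast Nat.le_of_lt_succ hc
  have hc0 : (0 : ℝ) ≤ c := by positivity
  refine ⟨by nlinarith, ?_⟩
  rw [third_pow]
  nlinarith

theorem level_inj {n i j : ℕ} {x : Base} (hi : i < 3 ^ n) (hj : j < 3 ^ n)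
    (hxi : x ∈ level n i) (hxj : x ∈ level n j) : i = j := by
  induction n generalizing i j with
  | zero => simp at hi hj; omega
  | succ n ih =>
    obtain ⟨c, i, hc, hi', rfl⟩ := exists_column_index hi
    obtain ⟨d, j, hd, hj', rfl⟩ := exists_column_index hj
    replace hi := hi'
    replace hj := hj'
    have hxi' := level_column_subset hc hi hxi
    have hxj' := level_column_subset hd hj hxj
    have hij := ih hi hj hxi' hxj'
    subst hij
    obtain ⟨h1, h2⟩ := hxi
    obtain ⟨h3, h4⟩ := hxj
    rw [levelLeft_column hi] at h1 h2 h3 h4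
    have hp : (0 : ℝ) < (1 / 3 : ℝ) ^ (n + 1) := by positivity
    have h5 : (c : ℝ) < d + 1 := lt_of_mul_lt_mul_right (by linarith) hp.le
    have h6 : (d : ℝ) < c + 1 := lt_of_mul_lt_mul_right (by linarith) hp.le
    have h7 : c < d + 1 := by exact_mod_cast h5
    have h8 : d < c + 1 := by exact_mod_cast h6
    have : c = d := by omega
    rw [this]

theorem levelIndex_spec (n : ℕ) (x : Base) :
    levelIndex n x < 3 ^ n ∧ x ∈ level n (levelIndex n x) := by
  classical
  exact Nat.find_spec (exists_level n x)

theorem levelIndex_eq {n i : ℕ} {x : Base} (hi : i < 3 ^ n) (hx : x ∈ level n i) :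
    levelIndex n x = i :=
  level_inj (levelIndex_spec n x).1 hi (levelIndex_spec n x).2 hx

theorem top_column (n : ℕ) : 3 ^ (n + 1) - 1 = 2 * 3 ^ n + (3 ^ n - 1) := by
  have : 0 < 3 ^ n := by positivity
  rw [pow_succ]
  omega

theorem top_antitone : Antitone top := by
  refine antitone_nat_of_succ_le fun n => ?_
  rw [top, top_column]
  exact level_column_subset (by norm_num) (Nat.sub_lt (by positivity) one_pos)

theorem not_mem_top_of_level {n i : ℕ} {x : Base} (hi : i + 1 < 3 ^ n) (hx : x ∈ level n i) :
    x ∉ top n := by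
  intro h
  have := level_inj (by omega) (by omega) hx h
  omega

theorem entryStep_eq {n : ℕ} {x : Base} (h : x ∈ top n) (h' : x ∉ top (n + 1)) :
    entryStep x = n + 1 := by
  classical
  rw [entryStep, Nat.find_eq_iff]
  refine ⟨⟨by omega, h'⟩, fun m hm hm' => hm'.2 (top_antitone (by omega) h)⟩

/-- The step from a level `k` of tower `n + 1` to the next one is either a step in tower `n`, or
the passage from the top of a column to the bottom of the next one. -/
theorem column_step {n k : ℕ} (hk : k + 1 < 3 ^ (n + 1)) :
    ∃ c i, c < 3 ∧ i < 3 ^ n ∧ k = c * 3 ^ n + i ∧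
      ((i + 1 < 3 ^ n ∧ k + 1 = c * 3 ^ n + (i + 1)) ∨
        (i = 3 ^ n - 1 ∧ c + 1 < 3 ∧ k + 1 = (c + 1) * 3 ^ n + 0)) := by
  obtain ⟨c, i, hc, hi, rfl⟩ := exists_column_index (show k < 3 ^ (n + 1) by omega)
  refine ⟨c, i, hc, hi, rfl, ?_⟩
  by_cases h : i + 1 < 3 ^ n
  · exact Or.inl ⟨h, by ring⟩
  · have hi' : i = 3 ^ n - 1 := by omega
    refine Or.inr ⟨hi', ?_, ?_⟩
    · by_contra hc'
      have : c = 2 := by omega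
      subst this
      rw [hi', ← top_column] at hk
      omega
    · rw [add_mul, one_mul, hi']
      omega

/-- The map uses the tower `n(x)`, yet its translation is the same in every tower where `x` is below
the top: inside a column the smaller tower already decides, and at the top of a column `n(x)` is
exactly the present tower. -/
theorem baseMap_val {n i : ℕ} {x : Base} (hi : i + 1 < 3 ^ n) (hx : x ∈ level n i) :
    (baseMap x : ℝ) = x + (levelLeft n (i + 1) - levelLeft n i) := by
  induction n generalizing i with
  | zero => simp at hi
  | succ n ih =>
    have hi0 : i < 3 ^ (n + 1) := by omega
    have hx' := hx
    have hi' := hi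
    obtain ⟨c, j, hc, hj, rfl, ⟨hj', h⟩ | ⟨hj', hc', h⟩⟩ := column_step hi
    · rw [h, levelLeft_column hj, levelLeft_column hj',
        ih hj' (level_column_subset hc hj hx)]
      ring
    · have ht : x ∈ top n := by
        rw [top, ← hj']
        exact level_column_subset hc hj hx
      change (x : ℝ) + shift (entryStep x) x = _
      rw [entryStep_eq ht (not_mem_top_of_level hi' hx'), shift, levelIndex_eq hi0 hx]

theorem baseMap_mem_level {n i : ℕ} {x : Base} (hi : i + 1 < 3 ^ n) (hx : x ∈ level n i) :
    baseMap x ∈ level n (i + 1) := by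
  rw [level, Set.mem_ofPred_eq, baseMap_val hi hx]
  obtain ⟨h1, h2⟩ := hx
  constructor <;> linarith

theorem iterate_baseMap_mem_level {n i : ℕ} {x : Base} (hx : x ∈ level n i) (k : ℕ)
    (hi : i + k < 3 ^ n) : baseMap^[k] x ∈ level n (i + k) := by
  induction k with
  | zero => exact hx
  | succ k ih =>
    rw [Function.iterate_succ_apply']
    exact baseMap_mem_level hi (ih (by omega))

theorem level_mod {m n i : ℕ} {x : Base} (hmn : m ≤ n) (hi : i < 3 ^ n) (hx : x ∈ level n i) :
    x ∈ level m (i % 3 ^ m) := by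
  induction n, hmn using Nat.le_induction generalizing i with
  | base => rwa [Nat.mod_eq_of_lt hi]
  | succ n hmn ih =>
    obtain ⟨c, j, hc, hj, rfl⟩ := exists_column_index hi
    have := ih hj (level_column_subset hc hj hx)
    obtain ⟨d, rfl⟩ := Nat.exists_eq_add_of_le hmn
    rwa [pow_add, mul_left_comm, Nat.mul_add_mod]

/-- Every point has room above it in all sufficiently high towers. -/
theorem exists_level_add_lt (x : Base) (k : ℕ) :
    ∃ N, ∀ n, N ≤ n → ∃ i, i + k < 3 ^ n ∧ x ∈ level n i := by
  induction k with
  | zero => exact ⟨0, fun n _ => exists_level n x⟩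
  | succ k ih =>
    obtain ⟨N, hN⟩ := ih
    obtain ⟨m, -, hm⟩ := exists_not_mem_top (baseMap^[k] x)
    refine ⟨max N m, fun n hn => ?_⟩
    obtain ⟨i, hi, hx⟩ := hN n (le_of_max_le_left hn)
    refine ⟨i, ?_, hx⟩
    by_contra h
    refine hm (top_antitone (le_of_max_le_right hn) ?_)
    rw [top, show 3 ^ n - 1 = i + k by omega]
    exact iterate_baseMap_mem_level hx k hi

/-- On levels, the map is addition of `1` modulo `3 ^ n`, even at the top level: in a higher tower
where `x` is not on top the index grows by one, and reduction modulo `3 ^ n` recovers the level of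
tower `n`. -/
theorem baseMap_mem_level_mod {n i : ℕ} {x : Base} (hi : i < 3 ^ n) (hx : x ∈ level n i) :
    baseMap x ∈ level n ((i + 1) % 3 ^ n) := by
  obtain ⟨N, hN⟩ := exists_level_add_lt x 1
  obtain ⟨j, hj, hxj⟩ := hN (max N n) (le_max_left _ _)
  have hnm := le_max_right N n
  have h1 := level_mod hnm (by omega) hxj
  have h2 := level_mod hnm hj (baseMap_mem_level hj hxj)
  obtain rfl := level_inj hi (Nat.mod_lt _ (by positivity)) hx h1
  rwa [Nat.mod_add_mod]

theorem baseMap_injective : Function.Injective baseMap := by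
  intro x y hxy
  obtain ⟨M, hM⟩ := exists_level_add_lt x 1
  obtain ⟨N, hN⟩ := exists_level_add_lt y 1
  obtain ⟨a, ha', hxa⟩ := hM (max M N) (le_max_left _ _)
  obtain ⟨b, hb', hyb⟩ := hN (max M N) (le_max_right _ _)
  have h := level_inj ha' hb' (baseMap_mem_level ha' hxa) (hxy ▸ baseMap_mem_level hb' hyb)
  obtain rfl : a = b := by omega
  have h1 := baseMap_val ha' hxa
  rw [hxy, baseMap_val ha' hyb] at h1
  exact Subtype.ext (by linarith)

theorem preimage_level_succ {n i : ℕ} (hi : i + 1 < 3 ^ n) :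
    baseMap ⁻¹' level n (i + 1) = level n i := by
  ext x
  refine ⟨fun h => ?_, baseMap_mem_level hi⟩
  obtain ⟨j, hj, hx⟩ := exists_level n x
  have h1 := level_inj hi (Nat.mod_lt _ (by positivity)) h (baseMap_mem_level_mod hj hx)
  by_cases hj' : j + 1 < 3 ^ n
  · rw [Nat.mod_eq_of_lt hj'] at h1
    rwa [show i = j by omega]
  · rw [show j + 1 = 3 ^ n by omega, Nat.mod_self] at h1
    omega

theorem preimage_level_zero (n : ℕ) : baseMap ⁻¹' level n 0 = top n := by
  have hp : 0 < 3 ^ n := by positivity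
  ext x
  constructor
  · intro h
    obtain ⟨j, hj, hx⟩ := exists_level n x
    have h1 := level_inj (by positivity) (Nat.mod_lt _ hp) h (baseMap_mem_level_mod hj hx)
    by_cases hj' : j + 1 < 3 ^ n
    · rw [Nat.mod_eq_of_lt hj'] at h1
      omega
    · rwa [top, show 3 ^ n - 1 = j by omega]
  · intro h
    have := baseMap_mem_level_mod (by omega) h
    rwa [show 3 ^ n - 1 + 1 = 3 ^ n by omega, Nat.mod_self] at this

/-! ### The base as a measure-preserving system -/

theorem measurableSet_level (n i : ℕ) : MeasurableSet (level n i) :=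
  (measurableSet_le measurable_const measurable_subtype_coe).inter
    (measurableSet_lt measurable_subtype_coe measurable_const)

/-- The levels of all towers. -/
def levels : Set (Set Base) := {s | ∃ n i, i < 3 ^ n ∧ s = level n i}

theorem countable_levels : levels.Countable := by
  refine (Set.countable_range fun p : ℕ × ℕ => level p.1 p.2).mono ?_
  rintro _ ⟨n, i, -, rfl⟩
  exact ⟨(n, i), rfl⟩

theorem isPiSystem_levels : IsPiSystem levels := by
  have key : ∀ {m n i j : ℕ}, m ≤ n → i < 3 ^ m → j < 3 ^ n → (level m i ∩ level n j).Nonempty →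
      level m i ∩ level n j = level n j := by
    rintro m n i j hmn hi hj ⟨x, hxi, hxj⟩
    refine Set.inter_eq_right.2 fun y hy => ?_
    have h := level_inj hi (Nat.mod_lt _ (by positivity)) hxi (level_mod hmn hj hxj)
    rw [h]
    exact level_mod hmn hj hy
  rintro _ ⟨m, i, hi, rfl⟩ _ ⟨n, j, hj, rfl⟩ h
  rcases le_total m n with hmn | hmn
  · exact ⟨n, j, hj, key hmn hi hj h⟩
  · rw [Set.inter_comm] at h ⊢
    exact ⟨m, i, hi, key hmn hj hi h⟩

theorem generateFrom_levels :
    (inferInstance : MeasurableSpace Base) = MeasurableSpace.generateFrom levels := by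
  apply le_antisymm
  · rw [BorelSpace.measurable_eq (α := Base), borel_eq_generateFrom_Iio]
    refine MeasurableSpace.generateFrom_le ?_
    rintro _ ⟨a, rfl⟩
    have : Set.Iio a = ⋃₀ {s ∈ levels | s ⊆ Set.Iio a} := by
      apply Set.Subset.antisymm
      · intro x hx
        have hxa : (0 : ℝ) < a - x := sub_pos.2 hx
        obtain ⟨n, hn⟩ := exists_pow_lt_of_lt_one hxa (by norm_num : (1 / 3 : ℝ) < 1)
        obtain ⟨i, hi, hxi⟩ := exists_level n x
        refine ⟨level n i, ⟨⟨n, i, hi, rfl⟩, fun y hy => ?_⟩, hxi⟩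
        have h1 := hy.2
        have h2 := hxi.1
        have h3 : (y : ℝ) < a := by linarith
        exact h3
      · exact Set.sUnion_subset fun s hs => hs.2
    rw [this]
    exact MeasurableSet.sUnion (countable_levels.mono fun s hs => hs.1)
      fun s hs => MeasurableSpace.measurableSet_generateFrom hs.1
  · refine MeasurableSpace.generateFrom_le ?_
    rintro _ ⟨n, i, -, rfl⟩
    exact measurableSet_level n i

theorem baseMeasure_apply (s : Set Base) : baseMeasure s = volume (Subtype.val '' s) :=
  (MeasurableEmbedding.subtype_coe measurableSet_Ico).comap_apply _ _

theorem image_level {n i : ℕ} (hi : i < 3 ^ n) :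
    Subtype.val '' level n i = Set.Ico (levelLeft n i) (levelLeft n i + (1 / 3 : ℝ) ^ n) := by
  obtain ⟨h0, h1⟩ := levelLeft_bounds n i hi
  ext x
  constructor
  · rintro ⟨y, hy, rfl⟩
    exact hy
  · intro hx
    exact ⟨⟨x, h0.trans hx.1, hx.2.trans_le h1⟩, hx, rfl⟩

theorem baseMeasure_level {n i : ℕ} (hi : i < 3 ^ n) :
    baseMeasure (level n i) = ENNReal.ofReal ((1 / 3 : ℝ) ^ n) := by
  rw [baseMeasure_apply, image_level hi, Real.volume_Ico, add_sub_cancel_left]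

instance : IsProbabilityMeasure baseMeasure :=
  ⟨by rw [baseMeasure_apply, Set.image_univ, Subtype.range_coe, Real.volume_Ico]; simp⟩

instance : NullSingletonClass baseMeasure :=
  ⟨fun x => by rw [baseMeasure_apply, Set.image_singleton, Real.volume_singleton]⟩

theorem preimage_mem_levels {s : Set Base} (hs : s ∈ levels) :
    baseMap ⁻¹' s ∈ levels ∧ baseMeasure (baseMap ⁻¹' s) = baseMeasure s := by
  obtain ⟨n, i, hi, rfl⟩ := hs
  have hp : 3 ^ n - 1 < 3 ^ n := Nat.sub_lt (by positivity) one_pos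
  cases i with
  | zero =>
    rw [preimage_level_zero, top, baseMeasure_level hi, baseMeasure_level hp]
    exact ⟨⟨n, _, hp, rfl⟩, rfl⟩
  | succ i =>
    rw [preimage_level_succ hi, baseMeasure_level hi, baseMeasure_level (by omega)]
    exact ⟨⟨n, i, by omega, rfl⟩, rfl⟩

theorem measurable_baseMap : Measurable baseMap := by
  have h := @measurable_generateFrom Base Base (.generateFrom levels) levels baseMap fun s hs =>
    MeasurableSpace.measurableSet_generateFrom (preimage_mem_levels hs).1
  rwa [← generateFrom_levels] at h

theorem measurePreserving_baseMap : MeasurePreserving baseMap baseMeasure baseMeasure := by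
  refine ⟨measurable_baseMap, ?_⟩
  have := Measure.isProbabilityMeasure_map (μ := baseMeasure) measurable_baseMap.aemeasurable
  refine ext_of_generate_finite levels generateFrom_levels isPiSystem_levels ?_ (by simp)
  intro s hs
  have hs' : MeasurableSet s := by
    obtain ⟨n, i, -, rfl⟩ := hs
    exact measurableSet_level n i
  rw [Measure.map_apply measurable_baseMap hs', (preimage_mem_levels hs).2]

/-- The levels of a tower are successive preimages of each other, so an invariant set has the same
mass in all `3 ^ n` of them. -/
theorem baseMeasure_inter_level {E : Set Base} (hE : MeasurableSet E) (hinv : baseMap ⁻¹' E = E)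
    {n i : ℕ} (hi : i < 3 ^ n) :
    baseMeasure (E ∩ level n i) = baseMeasure E * baseMeasure (level n i) := by
  have hconst : ∀ j, j < 3 ^ n → baseMeasure (E ∩ level n j) = baseMeasure (E ∩ level n 0) := by
    intro j
    induction j with
    | zero => intro _; rfl
    | succ j ih =>
      intro hj
      rw [← ih (by omega), ← measurePreserving_baseMap.measure_preimage
        (hE.inter (measurableSet_level n (j + 1))).nullMeasurableSet, Set.preimage_inter, hinv,
        preimage_level_succ hj]
  have hU : E = ⋃ j ∈ Finset.range (3 ^ n), E ∩ level n j := by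
    ext x
    obtain ⟨j, hj, hx⟩ := exists_level n x
    simp only [Set.mem_iUnion, Finset.mem_range, Set.mem_inter_iff, exists_prop]
    exact ⟨fun h => ⟨j, hj, h, hx⟩, fun ⟨_, _, h, _⟩ => h⟩
  have hsum : baseMeasure E = 3 ^ n * baseMeasure (E ∩ level n 0) := by
    conv_lhs => rw [hU]
    rw [measure_biUnion_finset]
    · rw [Finset.sum_congr rfl fun j hj => hconst j (Finset.mem_range.1 hj)]
      simp
    · intro a ha b hb hab
      refine Set.disjoint_left.2 fun x hxa hxb => hab ?_
      exact level_inj (by simpa using ha) (by simpa using hb) hxa.2 hxb.2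
    · exact fun j _ => hE.inter (measurableSet_level n j)
  rw [hconst i hi, hsum, baseMeasure_level hi, ENNReal.ofReal_pow (by norm_num), mul_comm,
    ← mul_assoc, ← mul_pow]
  have : ENNReal.ofReal (1 / 3) * 3 = 1 := by
    rw [show (3 : ℝ≥0∞) = ENNReal.ofReal 3 by simp, ← ENNReal.ofReal_mul (by norm_num)]
    norm_num
  rw [this, one_pow, one_mul]

/-- An invariant set is independent of every level, hence of every measurable set, hence of itself.
-/
theorem ergodic_baseMap : Ergodic baseMap baseMeasure := by
  refine ⟨measurePreserving_baseMap, ⟨fun E hE hinv => ?_⟩⟩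
  have h : baseMeasure.restrict E = baseMeasure E • baseMeasure := by
    refine ext_of_generate_finite levels generateFrom_levels isPiSystem_levels ?_ (by simp)
    rintro _ ⟨n, i, hi, rfl⟩
    rw [Measure.restrict_apply (measurableSet_level n i), Set.inter_comm,
      baseMeasure_inter_level hE hinv hi]
    rfl
  have h2 : baseMeasure E = baseMeasure E * baseMeasure E := by
    have := congrArg (fun ν : Measure Base => ν E) h
    simpa [Measure.restrict_apply hE] using this
  rw [eventuallyConst_set', ae_eq_empty, ae_eq_univ, prob_compl_eq_zero_iff hE]
  by_cases h0 : baseMeasure E = 0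
  · exact Or.inl h0
  · right
    have : baseMeasure E * baseMeasure E = baseMeasure E * 1 := by rw [← h2, mul_one]
    exact (ENNReal.mul_right_inj h0 (measure_ne_top _ _)).1 this

/-! ### The maps of the fibre -/

instance : DiscreteMeasurableSpace ℤˣ := ⟨fun s => by
  have hinj : Function.Injective (Units.val : ℤˣ → ℤ) := Units.val_injective
  exact ⟨Units.val '' s, .of_discrete, Set.preimage_image_eq s hinj⟩⟩

theorem tau_lower {n i : ℕ} (y : Fibre) (hi : i < 2 ^ n) : tau (n + 1) y i = y (i + 2 ^ n) := by
  simp [tau, hi]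

theorem tau_upper {n i : ℕ} (y : Fibre) (hi : i < 2 ^ n) :
    tau (n + 1) y (i + 2 ^ n) = y i * y (i + 2 ^ n) := by
  have h : i + 2 ^ n < 2 ^ (n + 1) := by rw [pow_succ]; omega
  simp [tau, h]

theorem tau_outside {n i : ℕ} (y : Fibre) (hi : 2 ^ (n + 1) ≤ i) : tau (n + 1) y i = y i := by
  have h : 2 ^ n ≤ i := by rw [pow_succ] at hi; omega
  simp [tau, h.not_gt, hi.not_gt]

theorem coord_cases (n i : ℕ) :
    i < 2 ^ n ∨ (∃ j, j < 2 ^ n ∧ i = j + 2 ^ n) ∨ 2 ^ (n + 1) ≤ i := by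
  by_cases h : i < 2 ^ n
  · exact Or.inl h
  by_cases h' : 2 ^ (n + 1) ≤ i
  · exact Or.inr (Or.inr h')
  · rw [pow_succ] at h'
    exact Or.inr (Or.inl ⟨i - 2 ^ n, by omega, by omega⟩)

/-- The only source of dependence between three times: the leading words of `y`, `tau y`, `tau (tau
y)` are `w₁`, `w₂`, `w₁ · w₂`. -/
theorem tau_tau_lower {n i : ℕ} (y : Fibre) (hi : i < 2 ^ n) :
    tau (n + 1) (tau (n + 1) y) i = y i * tau (n + 1) y i := by
  rw [tau_lower _ hi, tau_upper _ hi, tau_lower _ hi]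

/-- Signs square to `1`, so the pairs of words run through `(w₁, w₂)`, `(w₂, w₁w₂)`, `(w₁w₂, w₁)`
and back. -/
theorem tau_iterate_three (n : ℕ) (y : Fibre) :
    tau (n + 1) (tau (n + 1) (tau (n + 1) y)) = y := by
  have hsq : ∀ a : ℤˣ, a * a = 1 := Int.units_mul_self
  funext i
  rcases coord_cases n i with h | ⟨j, h, rfl⟩ | h
  · rw [tau_lower _ h, tau_upper _ h, tau_upper _ h, tau_lower _ h, mul_comm, mul_assoc, hsq,
      mul_one]
  · rw [tau_upper _ h, tau_upper _ h, tau_lower _ h, tau_upper _ h, tau_lower _ h]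
    generalize y j = a, y (j + 2 ^ n) = b
    revert a b
    decide
  · simp only [tau_outside _ h]

theorem tau_mul (n : ℕ) (y z : Fibre) : tau n (y * z) = tau n y * tau n z := by
  funext i
  simp only [tau, Pi.mul_apply]
  split_ifs
  · rfl
  · exact mul_mul_mul_comm _ _ _ _
  · rfl

theorem tau_bijective (n : ℕ) : Function.Bijective (tau (n + 1)) := by
  refine Function.bijective_iff_has_inverse.2 ⟨tau (n + 1) ∘ tau (n + 1), ?_, ?_⟩
  · exact tau_iterate_three n
  · exact tau_iterate_three n

theorem tauComp_bijective (n : ℕ) : Function.Bijective (tauComp n) := by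
  induction n with
  | zero => exact Function.bijective_id
  | succ n ih => exact (tau_bijective n).comp ih

theorem measurable_tau (n : ℕ) : Measurable (tau n) := by
  refine measurable_pi_lambda _ fun i => ?_
  unfold tau
  split_ifs
  · exact measurable_pi_apply _
  · exact (Measurable.of_discrete (f := fun p : ℤˣ × ℤˣ => p.1 * p.2)).comp
      (f := fun y : Fibre => (y (i - 2 ^ (n - 1)), y i))
      ((measurable_pi_apply _).prodMk (measurable_pi_apply _))
  · exact measurable_pi_apply _

theorem measurable_tauComp (n : ℕ) : Measurable (tauComp n) := by
  induction n with
  | zero => exact measurable_id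
  | succ n ih => exact (measurable_tau (n + 1)).comp ih

/-- `y` and `z` have the same first `N` coordinates. -/
def AgreeBelow (N : ℕ) (y z : Fibre) : Prop := ∀ i, i < N → y i = z i

theorem AgreeBelow.symm {N : ℕ} {y z : Fibre} (h : AgreeBelow N y z) : AgreeBelow N z y :=
  fun i hi => (h i hi).symm

theorem AgreeBelow.mono {M N : ℕ} {y z : Fibre} (h : AgreeBelow N y z) (hMN : M ≤ N) :
    AgreeBelow M y z :=
  fun i hi => h i (hi.trans_le hMN)

theorem AgreeBelow.tau {n N : ℕ} {y z : Fibre} (hN : 2 ^ (n + 1) ≤ N) (h : AgreeBelow N y z) :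
    AgreeBelow N (tau (n + 1) y) (tau (n + 1) z) := by
  intro i hi
  have h2 : 2 ^ (n + 1) = 2 ^ n + 2 ^ n := by rw [pow_succ]; omega
  rcases coord_cases n i with h' | ⟨j, h', rfl⟩ | h'
  · rw [tau_lower _ h', tau_lower _ h', h _ (by omega)]
  · rw [tau_upper _ h', tau_upper _ h', h _ (by omega), h _ (by omega)]
  · rw [tau_outside _ h', tau_outside _ h', h _ hi]

theorem AgreeBelow.tau_iterate {n N : ℕ} {y z : Fibre} (hN : 2 ^ (n + 1) ≤ N)
    (h : AgreeBelow N y z) (c : ℕ) :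
    AgreeBelow N ((TriadicSkew.tau (n + 1))^[c] y) ((TriadicSkew.tau (n + 1))^[c] z) := by
  induction c with
  | zero => exact h
  | succ c ih =>
    rw [Function.iterate_succ_apply', Function.iterate_succ_apply']
    exact ih.tau hN

/-- The set `C` depends only on the first `N` coordinates. -/
def DependsBelow (N : ℕ) (C : Set Fibre) : Prop := ∀ y z, AgreeBelow N y z → y ∈ C → z ∈ C

theorem DependsBelow.mono {M N : ℕ} {C : Set Fibre} (h : DependsBelow M C) (hMN : M ≤ N) :
    DependsBelow N C :=
  fun y z hyz => h y z (hyz.mono hMN)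

/-- The set of the points whose first `N` coordinates are those of `w`. -/
def cyl (N : ℕ) (w : Fibre) : Set Fibre := {y | AgreeBelow N w y}

theorem dependsBelow_cyl (N : ℕ) (w : Fibre) : DependsBelow N (cyl N w) :=
  fun _ _ hyz hy i hi => (hy i hi).trans (hyz i hi)

/-- The points whose coordinates from the `N`-th on are equal to `1`. -/
def padOne (N : ℕ) (v : Fin N → ℤˣ) : Fibre := fun i => if h : i < N then v ⟨i, h⟩ else 1

theorem DependsBelow.eq_iUnion {N : ℕ} {C : Set Fibre} (h : DependsBelow N C) :
    C = ⋃ v ∈ {v | padOne N v ∈ C}, cyl N (padOne N v) := by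
  ext y
  simp only [Set.mem_iUnion, Set.mem_ofPred_eq, exists_prop]
  constructor
  · intro hy
    have hag : AgreeBelow N y (padOne N fun i => y i) := fun i hi => by simp [padOne, hi]
    exact ⟨fun i => y i, h _ _ hag hy, hag.symm⟩
  · rintro ⟨v, hv, hy⟩
    exact h _ _ hy hv

theorem cyl_eq_pi (N : ℕ) (w : Fibre) :
    cyl N w = Set.pi (Finset.range N) fun i => {w i} := by
  ext y
  simp [cyl, AgreeBelow, eq_comm]

theorem measurableSet_cyl (N : ℕ) (w : Fibre) : MeasurableSet (cyl N w) := by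
  rw [cyl_eq_pi]
  exact MeasurableSet.pi (Finset.range N).countable_toSet fun _ _ => .of_discrete

theorem DependsBelow.measurableSet {N : ℕ} {C : Set Fibre} (h : DependsBelow N C) :
    MeasurableSet C := by
  rw [h.eq_iUnion]
  exact MeasurableSet.biUnion (Set.to_countable _) fun _ _ => measurableSet_cyl _ _

instance : IsProbabilityMeasure fibreMeasure := by
  unfold fibreMeasure
  infer_instance

theorem coin_singleton (a : ℤˣ) : coin {a} = 2⁻¹ := by
  rw [coin, PMF.toMeasure_apply_singleton _ _ (.of_discrete)]
  simp

theorem fibreMeasure_cyl (N : ℕ) (w : Fibre) : fibreMeasure (cyl N w) = 2⁻¹ ^ N := by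
  rw [cyl_eq_pi, fibreMeasure, Measure.infinitePi_pi _ fun _ _ => .of_discrete]
  simp [coin_singleton]

/-- The cylinders that fix at least the first `M` coordinates. -/
def cylinders (M : ℕ) : Set (Set Fibre) := {s | ∃ N w, M ≤ N ∧ s = cyl N w}

theorem isPiSystem_cylinders (M : ℕ) : IsPiSystem (cylinders M) := by
  have key : ∀ {N N' : ℕ} {w w' : Fibre}, N ≤ N' → (cyl N w ∩ cyl N' w').Nonempty →
      cyl N w ∩ cyl N' w' = cyl N' w' := by
    rintro N N' w w' h ⟨y, hy, hy'⟩
    refine Set.inter_eq_right.2 fun z hz i hi => ?_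
    rw [hy i hi, ← hy' i (by omega), hz i (by omega)]
  rintro _ ⟨N, w, hN, rfl⟩ _ ⟨N', w', hN', rfl⟩ h
  rcases le_total N N' with hle | hle
  · exact ⟨N', w', hN', key hle h⟩
  · rw [Set.inter_comm] at h ⊢
    exact ⟨N, w, hN, key hle h⟩

/-- Short cylinders are finite unions of longer ones and can be discarded. This allows `tau (n + 1)`
to be tested only on cylinders that contain its whole block of `2 ^ (n + 1)` coordinates. -/
theorem generateFrom_cylinders (M : ℕ) :
    (inferInstance : MeasurableSpace Fibre) = MeasurableSpace.generateFrom (cylinders M) := by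
  apply le_antisymm
  · refine iSup_le fun i => ?_
    rw [← measurable_iff_comap_le]
    refine @measurable_to_countable' _ _ _ _ (.generateFrom (cylinders M)) _ fun a => ?_
    have h : DependsBelow (max M (i + 1)) ((fun y : Fibre => y i) ⁻¹' {a}) := by
      intro y z hyz hy
      rw [Set.mem_preimage, ← hyz i (by omega)]
      exact hy
    rw [h.eq_iUnion]
    refine @MeasurableSet.biUnion _ _ (.generateFrom (cylinders M)) _ _ (Set.to_countable _) ?_
    exact fun v _ => MeasurableSpace.measurableSet_generateFrom ⟨_, _, le_max_left _ _, rfl⟩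
  · refine MeasurableSpace.generateFrom_le ?_
    rintro _ ⟨N, w, -, rfl⟩
    exact measurableSet_cyl N w

/-- Long cylinders are permuted with their length kept: the preimage of one is the cylinder of the
point moved by the inverse, which is the square. -/
theorem measurePreserving_tau (n : ℕ) :
    MeasurePreserving (tau (n + 1)) fibreMeasure fibreMeasure := by
  refine ⟨measurable_tau _, ?_⟩
  have := Measure.isProbabilityMeasure_map (μ := fibreMeasure) (measurable_tau (n + 1)).aemeasurable
  refine ext_of_generate_finite (cylinders (2 ^ (n + 1))) (generateFrom_cylinders _)
    (isPiSystem_cylinders _) ?_ (by simp)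
  rintro _ ⟨N, w, hN, rfl⟩
  have h : tau (n + 1) ⁻¹' cyl N w = cyl N (tau (n + 1) (tau (n + 1) w)) := by
    ext y
    constructor
    · intro hy
      have hy' := (AgreeBelow.tau hN hy).tau hN
      rwa [tau_iterate_three] at hy'
    · intro hy
      have hy' := AgreeBelow.tau hN hy
      rwa [tau_iterate_three] at hy'
  rw [Measure.map_apply (measurable_tau _) (measurableSet_cyl _ _), h, fibreMeasure_cyl,
    fibreMeasure_cyl]

theorem measurePreserving_tauComp (n : ℕ) :
    MeasurePreserving (tauComp n) fibreMeasure fibreMeasure := by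
  induction n with
  | zero => exact MeasurePreserving.id _
  | succ n ih => exact (measurePreserving_tau n).comp ih

/-! ### The cocycle along the towers -/

/-- The composition of the maps `S_x` along the orbit that climbs from level `0` to level `k` of
tower `n`. -/
def climb : ℕ → ℕ → Fibre → Fibre
  | 0, _ => id
  | n + 1, k => climb n (k % 3 ^ n) ∘ (tau (n + 1))^[k / 3 ^ n]

theorem climb_column {n c i : ℕ} (hi : i < 3 ^ n) (z : Fibre) :
    climb (n + 1) (c * 3 ^ n + i) z = climb n i ((tau (n + 1))^[c] z) := by
  rw [climb, column_mod hi, column_div hi, Function.comp_apply]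

theorem climb_zero (n : ℕ) (z : Fibre) : climb n 0 z = z := by
  induction n with
  | zero => rfl
  | succ n ih => simpa [climb] using ih

theorem climb_mul (n k : ℕ) (y z : Fibre) : climb n k (y * z) = climb n k y * climb n k z := by
  have h : ∀ (m c : ℕ) (y z : Fibre), (tau m)^[c] (y * z) = (tau m)^[c] y * (tau m)^[c] z := by
    intro m c y z
    induction c with
    | zero => rfl
    | succ c ih => simp only [Function.iterate_succ_apply', ih, tau_mul]
  induction n generalizing k y z with
  | zero => rfl
  | succ n ih => simp only [climb, Function.comp_apply, h, ih]

theorem AgreeBelow.climb {n N : ℕ} {y z : Fibre} (hN : 2 ^ n ≤ N) (h : AgreeBelow N y z) (k : ℕ) :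
    AgreeBelow N (climb n k y) (climb n k z) := by
  induction n generalizing k y z with
  | zero => exact h
  | succ n ih =>
    exact ih ((Nat.pow_le_pow_right two_pos n.le_succ).trans hN) (h.tau_iterate hN _) _

theorem DependsBelow.preimage_climb {n N : ℕ} {C : Set Fibre} (h : DependsBelow N C)
    (hN : 2 ^ n ≤ N) (k : ℕ) : DependsBelow N (TriadicSkew.climb n k ⁻¹' C) :=
  fun _ _ hyz hy => h _ _ (hyz.climb hN k) hy

theorem measurePreserving_climb (n k : ℕ) :
    MeasurePreserving (climb n k) fibreMeasure fibreMeasure := by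
  induction n generalizing k with
  | zero => exact MeasurePreserving.id _
  | succ n ih => exact (ih _).comp ((measurePreserving_tau n).iterate _)

theorem climb_bijective (n k : ℕ) : Function.Bijective (climb n k) := by
  induction n generalizing k with
  | zero => exact Function.bijective_id
  | succ n ih => exact (ih _).comp ((tau_bijective n).iterate _)

/-- The climb to the top of tower `n + 1` passes two column changes, hence contains the square of
`tau (n + 1)`; the last factor of `tauComp (n + 1)` completes the cube. -/
theorem tauComp_climb_top (n : ℕ) (z : Fibre) : tauComp n (climb n (3 ^ n - 1) z) = z := by
  induction n generalizing z with
  | zero => rfl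
  | succ n ih =>
    rw [top_column, climb_column (Nat.sub_lt (by positivity) one_pos), tauComp,
      Function.comp_apply, ih]
    exact tau_iterate_three n z

/-- At the top of column `c`, the factor `tauComp n` of `S_x` cancels the climb within the column
and `tau (n + 1)` raises the power from `c` to `c + 1`. Steps inside a column belong to a smaller
tower. -/
theorem cocycle_climb {n i : ℕ} {x : Base} (hi : i + 1 < 3 ^ n) (hx : x ∈ level n i) (z : Fibre) :
    cocycle x (climb n i z) = climb n (i + 1) z := by
  induction n generalizing i z with
  | zero => simp at hi
  | succ n ih =>
    have hx' := hx
    have hi' := hi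
    obtain ⟨c, j, hc, hj, rfl, ⟨hj', h⟩ | ⟨hj', hc', h⟩⟩ := column_step hi
    · rw [h, climb_column hj, climb_column hj', ih hj' (level_column_subset hc hj hx)]
    · have ht : x ∈ top n := by
        rw [top, ← hj']
        exact level_column_subset hc hj hx
      rw [cocycle, entryStep_eq ht (not_mem_top_of_level hi' hx'), h, climb_column hj,
        climb_column (by positivity), hj', tauComp, Function.comp_apply, tauComp_climb_top,
        climb_zero, Function.iterate_succ_apply']

/-- The cocycle of the `k`-th iterate of the skew product. -/
def iterCocycle : ℕ → Base → Fibre → Fibre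
  | 0, _ => id
  | k + 1, x => cocycle (baseMap^[k] x) ∘ iterCocycle k x

theorem iterate_skewMap (k : ℕ) (p : Space) :
    skewMap^[k] p = (baseMap^[k] p.1, iterCocycle k p.1 p.2) := by
  induction k with
  | zero => rfl
  | succ k ih =>
    rw [Function.iterate_succ_apply', ih, skewMap, Function.iterate_succ_apply']
    rfl

/-- As `climb n i` is bijective and preserves the measure, this turns any question on the fibre over
`x` into one at the bottom of a tower. -/
theorem iterCocycle_climb {n i k : ℕ} {x : Base} (hi : i + k < 3 ^ n) (hx : x ∈ level n i)
    (z : Fibre) : iterCocycle k x (climb n i z) = climb n (i + k) z := by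
  induction k with
  | zero => rfl
  | succ k ih =>
    have hi' : i + k + 1 < 3 ^ n := hi
    rw [iterCocycle, Function.comp_apply, ih (by omega),
      cocycle_climb hi' (iterate_baseMap_mem_level hx k (by omega)), add_assoc]

theorem measurePreserving_iterCocycle (k : ℕ) (x : Base) :
    MeasurePreserving (iterCocycle k x) fibreMeasure fibreMeasure := by
  induction k with
  | zero => exact MeasurePreserving.id _
  | succ k ih => exact (measurePreserving_tauComp _).comp ih

/-! ### Independence of the coordinates along an orbit -/

/-- `C` reads `w₁` and the preimage of `D` reads `w₂`: disjoint blocks of coordinates of a product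
measure. -/
theorem fibreMeasure_inter_preimage_tau {n : ℕ} {C D : Set Fibre} (hC : DependsBelow (2 ^ n) C)
    (hD : DependsBelow (2 ^ n) D) :
    fibreMeasure (C ∩ tau (n + 1) ⁻¹' D) = fibreMeasure C * fibreMeasure D := by
  have hind : iIndepFun (fun i (y : Fibre) => y i) fibreMeasure :=
    iIndepFun_infinitePi (X := fun _ a => a) fun _ => measurable_id
  have h := hind.indepFun_finset (Finset.range (2 ^ n)) (Finset.Ico (2 ^ n) (2 ^ (n + 1)))
    (by
      rw [Finset.disjoint_left]
      intro i hi hi'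
      simp at hi hi'
      omega) fun i => measurable_pi_apply i
  have hC' : C = (fun (y : Fibre) (i : Finset.range (2 ^ n)) => y i) ⁻¹'
      ((fun (y : Fibre) (i : Finset.range (2 ^ n)) => y i) '' C) := by
    refine (Set.subset_preimage_image _ _).antisymm ?_
    rintro y ⟨z, hz, hzy⟩
    exact hC z y (fun i hi => congrFun hzy ⟨i, Finset.mem_range.2 hi⟩) hz
  have hD' : tau (n + 1) ⁻¹' D =
      (fun (y : Fibre) (i : Finset.Ico (2 ^ n) (2 ^ (n + 1))) => y i) ⁻¹'
      ((fun (y : Fibre) (i : Finset.Ico (2 ^ n) (2 ^ (n + 1))) => y i) '' (tau (n + 1) ⁻¹' D)) := by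
    refine (Set.subset_preimage_image _ _).antisymm ?_
    rintro y ⟨z, hz, hzy⟩
    refine hD _ _ (fun i hi => ?_) hz
    rw [tau_lower _ hi, tau_lower _ hi]
    refine congrFun hzy ⟨i + 2 ^ n, ?_⟩
    rw [Finset.mem_Ico, pow_succ]
    omega
  have h2 := h.measure_inter_preimage_eq_mul _ _ (Set.toFinite
    ((fun (y : Fibre) (i : Finset.range (2 ^ n)) => y i) '' C)).measurableSet (Set.toFinite
    ((fun (y : Fibre) (i : Finset.Ico (2 ^ n) (2 ^ (n + 1))) => y i) ''
      (tau (n + 1) ⁻¹' D))).measurableSet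
  rw [← hC', ← hD'] at h2
  rw [h2, (measurePreserving_tau n).measure_preimage hD.measurableSet.nullMeasurableSet]

theorem fibreMeasure_inter_preimage_iterate_tau {n c d : ℕ} {C D : Set Fibre}
    (hC : DependsBelow (2 ^ n) C) (hD : DependsBelow (2 ^ n) D) (hc : c < 3) (hd : d < 3)
    (hcd : c ≠ d) :
    fibreMeasure ((tau (n + 1))^[c] ⁻¹' C ∩ (tau (n + 1))^[d] ⁻¹' D) =
      fibreMeasure C * fibreMeasure D := by
  have hmp := measurePreserving_tau n
  have hCm := hC.measurableSet
  have hDm := hD.measurableSet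
  have key : ∀ {C D : Set Fibre} {c d : ℕ}, DependsBelow (2 ^ n) C → DependsBelow (2 ^ n) D →
      c < 3 → d < 3 → c < d →
      fibreMeasure ((tau (n + 1))^[c] ⁻¹' C ∩ (tau (n + 1))^[d] ⁻¹' D) =
        fibreMeasure C * fibreMeasure D := by
    clear! C D c d
    intro C D c d hC hD hc hd hcd
    have hCm := hC.measurableSet
    have hDm := hD.measurableSet
    obtain ⟨rfl, rfl⟩ | ⟨rfl, rfl⟩ | ⟨rfl, rfl⟩ :
        c = 0 ∧ d = 1 ∨ c = 1 ∧ d = 2 ∨ c = 0 ∧ d = 2 := by omega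
    · exact fibreMeasure_inter_preimage_tau hC hD
    · have h : (tau (n + 1))^[1] ⁻¹' C ∩ (tau (n + 1))^[2] ⁻¹' D =
          tau (n + 1) ⁻¹' (C ∩ tau (n + 1) ⁻¹' D) := rfl
      rw [h, hmp.measure_preimage (hCm.inter (hmp.measurable hDm)).nullMeasurableSet,
        fibreMeasure_inter_preimage_tau hC hD]
    -- One more pullback turns the exponents `0, 2` into `1, 3`, and the third power is the
    -- identity, so this is the adjacent case with the sets exchanged.
    · have h : tau (n + 1) ⁻¹' ((tau (n + 1))^[0] ⁻¹' C ∩ (tau (n + 1))^[2] ⁻¹' D) =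
          D ∩ tau (n + 1) ⁻¹' C := by
        ext y
        change tau (n + 1) y ∈ C ∧ tau (n + 1) (tau (n + 1) (tau (n + 1) y)) ∈ D ↔ _
        rw [tau_iterate_three, and_comm]
        rfl
      have hm : MeasurableSet ((tau (n + 1))^[0] ⁻¹' C ∩ (tau (n + 1))^[2] ⁻¹' D) :=
        hCm.inter ((hmp.iterate 2).measurable hDm)
      rw [← hmp.measure_preimage hm.nullMeasurableSet, h,
        fibreMeasure_inter_preimage_tau hD hC, mul_comm]
  rcases lt_or_gt_of_ne hcd with h | h
  · exact key hC hD hc hd h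
  · rw [Set.inter_comm, key hD hC hd hc h, mul_comm]

/-- Induction on the tower. If both positions lie in the same column, the common power of `tau`
drops out by invariance; if not, two different powers appear and the previous lemma applies, since
pullbacks by `climb n` still depend on `2 ^ n` coordinates only. At `n = m` both quotients are `0`,
so there is nothing to prove. -/
theorem fibreMeasure_inter_preimage_climb {m n i j : ℕ} {C D : Set Fibre} (hmn : m ≤ n)
    (hC : DependsBelow (2 ^ m) C) (hD : DependsBelow (2 ^ m) D) (hi : i < 3 ^ n) (hj : j < 3 ^ n)
    (hij : i / 3 ^ m ≠ j / 3 ^ m) :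
    fibreMeasure (climb n i ⁻¹' C ∩ climb n j ⁻¹' D) = fibreMeasure C * fibreMeasure D := by
  induction n, hmn using Nat.le_induction generalizing i j with
  | base => exact absurd (by rw [Nat.div_eq_of_lt hi, Nat.div_eq_of_lt hj]) hij
  | succ n hmn ih =>
    have hpre : ∀ {c i : ℕ} (C : Set Fibre), i < 3 ^ n →
        climb (n + 1) (c * 3 ^ n + i) ⁻¹' C = (tau (n + 1))^[c] ⁻¹' (climb n i ⁻¹' C) := by
      intro c i C hi
      ext z
      rw [Set.mem_preimage, climb_column hi]
      rfl
    obtain ⟨c, i', hc, hi', rfl⟩ := exists_column_index hi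
    obtain ⟨d, j', hd, hj', rfl⟩ := exists_column_index hj
    have hpow : 2 ^ m ≤ 2 ^ n := Nat.pow_le_pow_right two_pos hmn
    have hC' := (hC.mono hpow).preimage_climb le_rfl i'
    have hD' := (hD.mono hpow).preimage_climb le_rfl j'
    rw [hpre C hi', hpre D hj']
    by_cases hcd : c = d
    · subst hcd
      rw [← Set.preimage_inter, ((measurePreserving_tau n).iterate c).measure_preimage
        (hC'.measurableSet.inter hD'.measurableSet).nullMeasurableSet]
      refine ih hi' hj' fun h => hij ?_
      obtain ⟨e, rfl⟩ := Nat.exists_eq_add_of_le hmn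
      rw [pow_add, mul_left_comm, Nat.mul_add_div (by positivity), Nat.mul_add_div (by positivity),
        h]
    · rw [fibreMeasure_inter_preimage_iterate_tau hC' hD' hc hd hcd,
        (measurePreserving_climb n i').measure_preimage hC.measurableSet.nullMeasurableSet,
        (measurePreserving_climb n j').measure_preimage hD.measurableSet.nullMeasurableSet]

theorem fibreMeasure_inter_preimage_iterCocycle {m k : ℕ} {C D : Set Fibre} (x : Base)
    (hC : DependsBelow (2 ^ m) C) (hD : DependsBelow (2 ^ m) D) (hk : 3 ^ m ≤ k) :
    fibreMeasure (C ∩ iterCocycle k x ⁻¹' D) = fibreMeasure C * fibreMeasure D := by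
  obtain ⟨N, hN⟩ := exists_level_add_lt x k
  obtain ⟨i, hi, hx⟩ := hN (max N m) (le_max_left _ _)
  have h : climb (max N m) i ⁻¹' (C ∩ iterCocycle k x ⁻¹' D) =
      climb (max N m) i ⁻¹' C ∩ climb (max N m) (i + k) ⁻¹' D := by
    ext z
    simp only [Set.mem_preimage, Set.mem_inter_iff, iterCocycle_climb hi hx]
  rw [← (measurePreserving_climb (max N m) i).measure_preimage (hC.measurableSet.inter
    ((measurePreserving_iterCocycle k x).measurable hD.measurableSet)).nullMeasurableSet, h]
  refine fibreMeasure_inter_preimage_climb (le_max_right _ _) hC hD (by omega) hi ?_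
  -- A delay of at least `3 ^ m` forces a different copy of tower `m`.
  have h1 : (i + 3 ^ m) / 3 ^ m ≤ (i + k) / 3 ^ m := Nat.div_le_div_right (by omega)
  rw [Nat.add_div_right _ (by positivity)] at h1
  omega

/-- The event `y_0 = 1` in the fibre. -/
def firstCoordOne : Set Fibre := {y | y 0 = 1}

theorem dependsBelow_firstCoordOne : DependsBelow (2 ^ 0) firstCoordOne := by
  intro y z hyz hy
  rw [firstCoordOne, Set.mem_ofPred_eq, ← hyz 0 (by simp)]
  exact hy

theorem fibreMeasure_firstCoordOne : fibreMeasure firstCoordOne = 2⁻¹ := by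
  have : firstCoordOne = cyl 1 1 := by
    ext y
    simp [firstCoordOne, cyl, AgreeBelow, eq_comm]
  rw [this, fibreMeasure_cyl, pow_one]

/-- Over the first column of tower `n`, the zeroth coordinates at the times `0`, `3 ^ n`,
`2 * 3 ^ n` have product `1`. -/
theorem iterCocycle_two_mul_apply_zero {n i : ℕ} {x : Base} (hi : i < 3 ^ n)
    (hx : x ∈ level (n + 1) i) (y : Fibre) :
    iterCocycle (2 * 3 ^ n) x y 0 = y 0 * iterCocycle (3 ^ n) x y 0 := by
  -- Trace `y` back to the point `z` at the bottom of tower `n + 1`.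
  obtain ⟨z, rfl⟩ := (climb_bijective (n + 1) i).2 y
  have h1 : i + 3 ^ n < 3 ^ (n + 1) := by rw [pow_succ]; omega
  have h2 : i + 2 * 3 ^ n < 3 ^ (n + 1) := by rw [pow_succ]; omega
  rw [iterCocycle_climb h1 hx, iterCocycle_climb h2 hx]
  have e0 := climb_column (c := 0) hi z
  have e1 := climb_column (c := 1) hi z
  have e2 := climb_column (c := 2) hi z
  rw [zero_mul, zero_add] at e0
  rw [one_mul, add_comm _ i] at e1
  rw [add_comm _ i] at e2
  -- The three values are the images of `z`, `tau z`, `tau (tau z)` under the same multiplicative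
  -- map `climb n i`, which respects agreement of the first `2 ^ n` coordinates.
  rw [e0, e1, e2, ← Pi.mul_apply, ← climb_mul]
  refine AgreeBelow.climb le_rfl (fun k hk => ?_) i 0 (by positivity)
  exact tau_tau_lower z hk

/-- The product relation makes the third event a consequence of the first two, which are
independent. -/
theorem fibreMeasure_triple {n i : ℕ} {x : Base} (hi : i < 3 ^ n) (hx : x ∈ level (n + 1) i) :
    fibreMeasure (firstCoordOne ∩ iterCocycle (3 ^ n) x ⁻¹' firstCoordOne ∩
      iterCocycle (2 * 3 ^ n) x ⁻¹' firstCoordOne) = 2⁻¹ * 2⁻¹ := by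
  have h : firstCoordOne ∩ iterCocycle (3 ^ n) x ⁻¹' firstCoordOne ∩
      iterCocycle (2 * 3 ^ n) x ⁻¹' firstCoordOne =
      firstCoordOne ∩ iterCocycle (3 ^ n) x ⁻¹' firstCoordOne := by
    refine Set.inter_eq_left.2 fun y hy => ?_
    have h0 : y 0 = 1 := hy.1
    have h1 : iterCocycle (3 ^ n) x y 0 = 1 := hy.2
    change iterCocycle (2 * 3 ^ n) x y 0 = 1
    rw [iterCocycle_two_mul_apply_zero hi hx, h0, h1, one_mul]
  rw [h, fibreMeasure_inter_preimage_iterCocycle x dependsBelow_firstCoordOne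
    dependsBelow_firstCoordOne (Nat.pow_le_pow_right (by norm_num) n.zero_le),
    fibreMeasure_firstCoordOne]

/-! ### General facts -/

/-- By Lusin–Souslin an injective measurable map of standard Borel spaces is a measurable embedding,
so it has a measurable left inverse; its range has full measure because its preimage is everything.
-/
theorem isAutomorphism_of_injective {X : Type*} [MeasurableSpace X] [StandardBorelSpace X]
    [Nonempty X] {μ : Measure X} [IsProbabilityMeasure μ] {T : X → X}
    (hT : MeasurePreserving T μ μ) (hinj : Function.Injective T) : IsAutomorphism μ T := by
  have hemb := hT.measurable.measurableEmbedding hinj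
  obtain ⟨S, hS, hST⟩ := hemb.exists_measurable_extend measurable_id fun _ => inferInstance
  have hST' : ∀ x, S (T x) = x := fun x => congrFun hST x
  refine ⟨hT, S, ⟨hS, ?_⟩, ae_of_all _ hST', ?_⟩
  · conv_lhs => rw [← hT.map_eq]
    rw [Measure.map_map hS hT.measurable, hST, Measure.map_id]
  · have hr : ∀ᵐ x ∂μ, x ∈ Set.range T := by
      change μ (Set.range T)ᶜ = 0
      rw [← hT.measure_preimage hemb.measurableSet_range.compl.nullMeasurableSet,
        Set.preimage_compl, Set.preimage_range, Set.compl_univ, measure_empty]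
    filter_upwards [hr] with x hx
    obtain ⟨y, rfl⟩ := hx
    rw [hST']

/-- A sequence of subadditive set functions that are dominated by a finite measure and do not
increase under complements tends to `0` on all measurable sets if it does so on a generating
π-system. -/
theorem tendsto_zero_of_generateFrom {Z : Type*} [mZ : MeasurableSpace Z] {μ : Measure Z}
    [IsFiniteMeasure μ] {C : Set (Set Z)} (hgen : mZ = MeasurableSpace.generateFrom C)
    (hpi : IsPiSystem C) {a : ℕ → Set Z → ℝ≥0∞}
    (hbound : ∀ k s, MeasurableSet s → a k s ≤ μ s)
    (hcompl : ∀ k s, MeasurableSet s → a k sᶜ ≤ a k s)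
    (hunion : ∀ k s t, MeasurableSet s → MeasurableSet t → Disjoint s t →
      a k (s ∪ t) ≤ a k s + a k t)
    (hC : ∀ s ∈ C, Tendsto (fun k => a k s) atTop (nhds 0)) {s : Set Z} (hs : MeasurableSet s) :
    Tendsto (fun k => a k s) atTop (nhds 0) := by
  have squeeze : ∀ {u v : ℕ → ℝ≥0∞}, (∀ k, u k ≤ v k) → Tendsto v atTop (nhds 0) →
      Tendsto u atTop (nhds 0) := fun huv hv =>
    tendsto_of_tendsto_of_tendsto_of_le_of_le tendsto_const_nhds hv (fun _ => bot_le) huv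
  have hempty : Tendsto (fun k => a k ∅) atTop (nhds 0) := by
    refine squeeze (fun k => ?_) tendsto_const_nhds
    simpa using hbound k ∅ MeasurableSet.empty
  induction s, hs using MeasurableSpace.induction_on_inter hgen hpi with
  | empty => exact hempty
  | basic s hs => exact hC s hs
  | compl s hs ih => exact squeeze (fun k => hcompl k s hs) ih
  | iUnion f hf hfm ih =>
    have hpart : ∀ n, MeasurableSet (⋃ i < n, f i) := fun n =>
      MeasurableSet.biUnion (Set.to_countable _) fun i _ => hfm i
    have hpartial : ∀ n, Tendsto (fun k => a k (⋃ i < n, f i)) atTop (nhds 0) := by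
      intro n
      induction n with
      | zero => simpa using hempty
      | succ n ihn =>
        refine squeeze (v := fun k => a k (⋃ i < n, f i) + a k (f n)) (fun k => ?_)
          (by simpa using ihn.add (ih n))
        have h : ⋃ i < n + 1, f i = (⋃ i < n, f i) ∪ f n := Set.biUnion_lt_succ f n
        rw [h]
        refine hunion k _ _ (hpart n) (hfm n) (Set.disjoint_left.2 fun x hx hx' => ?_)
        simp only [Set.mem_iUnion, exists_prop] at hx
        obtain ⟨i, hi, hxi⟩ := hx
        exact Set.disjoint_left.1 (hf (Nat.ne_of_lt hi)) hxi hx'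
    -- Cut the union at `n`: the measure of the tail bounds its contribution uniformly in the index
    -- `k`, and the finite part is handled by subadditivity.
    rw [ENNReal.tendsto_nhds_zero]
    intro ε hε
    have hε2 : 0 < ε / 2 := ENNReal.half_pos hε.ne'
    have htail := tendsto_measure_biUnion_Ici_zero_of_pairwise_disjoint (μ := μ)
      (fun i => (hfm i).nullMeasurableSet) hf
    obtain ⟨n, hn⟩ := (ENNReal.tendsto_nhds_zero.1 htail _ hε2).exists
    have htm : MeasurableSet (⋃ i ≥ n, f i) :=
      MeasurableSet.biUnion (Set.to_countable _) fun i _ => hfm i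
    have hsplit : ⋃ i, f i = (⋃ i < n, f i) ∪ ⋃ i ≥ n, f i := by
      ext x
      simp only [Set.mem_iUnion, Set.mem_union, exists_prop]
      constructor
      · rintro ⟨i, hi⟩
        rcases lt_or_ge i n with h | h
        · exact Or.inl ⟨i, h, hi⟩
        · exact Or.inr ⟨i, h, hi⟩
      · rintro (⟨i, -, hi⟩ | ⟨i, -, hi⟩) <;> exact ⟨i, hi⟩
    have hdisj : Disjoint (⋃ i < n, f i) (⋃ i ≥ n, f i) := by
      refine Set.disjoint_left.2 fun x hx hx' => ?_
      simp only [Set.mem_iUnion, exists_prop] at hx hx'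
      obtain ⟨i, hi, hxi⟩ := hx
      obtain ⟨j, hj, hxj⟩ := hx'
      exact Set.disjoint_left.1 (hf (show i ≠ j by omega)) hxi hxj
    filter_upwards [ENNReal.tendsto_nhds_zero.1 (hpartial n) _ hε2] with k hk
    rw [hsplit]
    calc _ ≤ a k (⋃ i < n, f i) + a k (⋃ i ≥ n, f i) := hunion k _ _ (hpart n) htm hdisj
      _ ≤ ε / 2 + ε / 2 := add_le_add hk ((hbound k _ htm).trans hn)
      _ = ε := ENNReal.add_halves ε

/-- The correlation of two events. -/
def setCov {Y : Type*} [MeasurableSpace Y] (ν : Measure Y) (s t : Set Y) : ℝ :=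
  ν.real (s ∩ t) - ν.real s * ν.real t

theorem setCov_comm {Y : Type*} [MeasurableSpace Y] (ν : Measure Y) (s t : Set Y) :
    setCov ν s t = setCov ν t s := by
  rw [setCov, setCov, Set.inter_comm, mul_comm]

section setCov

variable {Y : Type*} [MeasurableSpace Y] (ν : Measure Y) [IsProbabilityMeasure ν]

theorem enorm_setCov_le (s t : Set Y) : ‖setCov ν s t‖ₑ ≤ ν t := by
  rw [Real.enorm_eq_ofReal_abs, ← ENNReal.ofReal_toReal (measure_ne_top ν t)]
  refine ENNReal.ofReal_le_ofReal (abs_le.2 ?_)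
  change -ν.real t ≤ _ ∧ _ ≤ ν.real t
  have h1 : ν.real (s ∩ t) ≤ ν.real t := measureReal_mono Set.inter_subset_right
  have h2 : 0 ≤ ν.real (s ∩ t) := measureReal_nonneg
  have h3 : 0 ≤ ν.real s := measureReal_nonneg
  have h4 : ν.real s ≤ 1 := measureReal_le_one
  have h5 : 0 ≤ ν.real t := measureReal_nonneg
  rw [setCov]
  constructor <;> nlinarith

theorem setCov_union (s : Set Y) {t u : Set Y} (hs : MeasurableSet s) (hu : MeasurableSet u)
    (htu : Disjoint t u) : setCov ν s (t ∪ u) = setCov ν s t + setCov ν s u := by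
  rw [setCov, Set.inter_union_distrib_left, measureReal_union htu hu,
    measureReal_union (htu.mono Set.inter_subset_right Set.inter_subset_right) (hs.inter hu),
    setCov, setCov]
  ring

theorem setCov_compl {s t : Set Y} (hs : MeasurableSet s) (ht : MeasurableSet t) :
    setCov ν s tᶜ = -setCov ν s t := by
  have h := setCov_union ν s hs ht.compl disjoint_compl_right
  rw [Set.union_compl_self] at h
  have h2 : setCov ν s Set.univ = 0 := by simp [setCov]
  linarith

end setCov

/-! ### The skew product as a measure-preserving system -/

instance : IsProbabilityMeasure skewMeasure := by
  unfold skewMeasure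
  infer_instance

theorem measurable_entryStep : Measurable entryStep := by
  classical
  refine measurable_find _ fun n => ?_
  exact (MeasurableSet.const _).inter (measurableSet_level _ _).compl

theorem measurable_cocycle : Measurable (Function.uncurry cocycle) := by
  have h : Measurable fun q : ℕ × Fibre => tauComp q.1 q.2 :=
    measurable_from_prod_countable_right fun n => measurable_tauComp n
  exact h.comp ((measurable_entryStep.comp measurable_fst).prodMk measurable_snd)

theorem measurePreserving_skewMap : MeasurePreserving skewMap skewMeasure skewMeasure :=
  measurePreserving_baseMap.skew_product measurable_cocycle
    (ae_of_all _ fun x => (measurePreserving_tauComp (entryStep x)).map_eq)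

theorem skewMap_injective : Function.Injective skewMap := by
  rintro ⟨x, y⟩ ⟨x', y'⟩ h
  obtain ⟨h1, h2⟩ := Prod.ext_iff.1 h
  obtain rfl := baseMap_injective h1
  obtain rfl := (tauComp_bijective (entryStep x)).1 h2
  rfl

instance : StandardBorelSpace Base := measurableSet_Ico.standardBorel

instance : Nonempty Base := ⟨⟨0, by simp⟩⟩

instance : StandardBorelSpace ℤˣ :=
  letI : TopologicalSpace ℤˣ := ⊥
  haveI : DiscreteTopology ℤˣ := ⟨rfl⟩
  haveI : BorelSpace ℤˣ := ⟨by
    rw [borel_eq_top_of_discrete]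
    exact eq_top_iff.2 fun s _ => .of_discrete⟩
  inferInstance

instance : NullSingletonClass skewMeasure := by
  unfold skewMeasure
  infer_instance

/-- The injective map `baseMap` is a measurable embedding, so pulling back the Borel sets of the
base gives all of them; the equality is exact, not only up to null sets. -/
theorem isFactor_baseFactor : IsFactor skewMap baseFactor := by
  refine ⟨measurable_fst.comap_le, ?_⟩
  have h := (measurable_baseMap.measurableEmbedding baseMap_injective).comap_eq
  have h2 : Prod.fst ∘ skewMap = baseMap ∘ Prod.fst := rfl
  rw [MeasurableSpace.comap_comp, h2, ← MeasurableSpace.comap_comp, h]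

/-! ### Conditional measures given the base -/

/-- The measure of the fibre of `A` over `x`. -/
def fibreMass (A : Set Space) (x : Base) : ℝ := fibreMeasure.real (Prod.mk x ⁻¹' A)

theorem measurable_fibreMass {A : Set Space} (hA : MeasurableSet A) : Measurable (fibreMass A) :=
  (measurable_measure_prodMk_left hA).ennreal_toReal

/-- Fubini: integrating the fibre masses over `E` gives the measure of the part of `A` above `E`.
All conditional statements thereby become statements about the fibre over a fixed `x`. -/
theorem condExp_ae_eq_fibreMass {A : Set Space} (hA : MeasurableSet A) :
    skewMeasure⟦A | baseFactor⟧ =ᵐ[skewMeasure] fun p => fibreMass A p.1 := by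
  have hle : baseFactor ≤ (inferInstance : MeasurableSpace Space) := measurable_fst.comap_le
  have hint : Integrable (fun p : Space => fibreMass A p.1) skewMeasure := by
    refine Integrable.of_bound ((measurable_fibreMass hA).comp measurable_fst).aestronglyMeasurable
      1 (ae_of_all _ fun p => ?_)
    rw [fibreMass, Real.norm_of_nonneg measureReal_nonneg]
    exact measureReal_le_one
  refine (ae_eq_condExp_of_forall_setIntegral_eq hle ?_ (fun s _ _ => hint.integrableOn) ?_ ?_).symm
  · exact (integrable_const (1 : ℝ)).indicator hA
  · rintro _ ⟨E, hE, rfl⟩ -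
    have hprod : skewMeasure.restrict (Prod.fst ⁻¹' E) =
        (baseMeasure.restrict E).prod fibreMeasure := by
      rw [← Set.prod_univ, skewMeasure, ← Measure.prod_restrict, Measure.restrict_univ]
    rw [setIntegral_indicator hA, hprod]
    have hfst := integral_fun_fst (μ := baseMeasure.restrict E) (ν := fibreMeasure) (fibreMass A)
    rw [hfst]
    simp only [probReal_univ, setIntegral_const, smul_eq_mul, mul_one, one_mul]
    have h1 : skewMeasure (Prod.fst ⁻¹' E ∩ A) =
        ∫⁻ x in E, fibreMeasure (Prod.mk x ⁻¹' A) ∂baseMeasure := by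
      rw [Set.inter_comm, ← Measure.restrict_apply hA, hprod, Measure.prod_apply hA]
    rw [measureReal_def, h1, ← integral_toReal]
    · rfl
    · exact (measurable_measure_prodMk_left hA).aemeasurable
    · exact ae_of_all _ fun x => measure_lt_top _ _
  · exact ((measurable_fibreMass hA).comp (comap_measurable Prod.fst)).aestronglyMeasurable

theorem preimage_mk_iterate (k : ℕ) (x : Base) (B : Set Space) :
    Prod.mk x ⁻¹' (skewMap^[k] ⁻¹' B) =
      iterCocycle k x ⁻¹' (Prod.mk (baseMap^[k] x) ⁻¹' B) := by
  ext y
  simp only [Set.mem_preimage, iterate_skewMap]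

theorem measurableSet_preimage_iterate (k : ℕ) {B : Set Space} (hB : MeasurableSet B) :
    MeasurableSet (skewMap^[k] ⁻¹' B) :=
  (measurePreserving_skewMap.iterate k).measurable hB

/-- The conditional correlation of `A` and `T⁻ᵏ B` over `x`. -/
def fibreCov (k : ℕ) (A B : Set Space) (x : Base) : ℝ :=
  setCov fibreMeasure (Prod.mk x ⁻¹' A) (Prod.mk x ⁻¹' (skewMap^[k] ⁻¹' B))

theorem fibreCov_eq (k : ℕ) (A B : Set Space) (x : Base) : fibreCov k A B x =
    fibreMass (A ∩ skewMap^[k] ⁻¹' B) x - fibreMass A x * fibreMass (skewMap^[k] ⁻¹' B) x := rfl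

theorem measurable_fibreCov (k : ℕ) {A B : Set Space} (hA : MeasurableSet A)
    (hB : MeasurableSet B) : Measurable (fibreCov k A B) := by
  have hB' := measurableSet_preimage_iterate k hB
  exact (measurable_fibreMass (hA.inter hB')).sub
    ((measurable_fibreMass hA).mul (measurable_fibreMass hB'))

/-- The rectangles whose second side is a cylinder. -/
def rectangles : Set (Set Space) :=
  Set.image2 (· ×ˢ ·) {E : Set Base | MeasurableSet E} (cylinders 0)

theorem isPiSystem_rectangles : IsPiSystem rectangles :=
  MeasurableSpace.isPiSystem_measurableSet.prod (isPiSystem_cylinders 0)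

theorem generateFrom_rectangles :
    (inferInstance : MeasurableSpace Space) = MeasurableSpace.generateFrom rectangles := by
  refine (generateFrom_eq_prod MeasurableSpace.generateFrom_measurableSet
    (generateFrom_cylinders 0).symm isCountablySpanning_measurableSet ?_).symm
  refine ⟨fun _ => cyl 0 1, fun _ => ⟨0, 1, le_rfl, rfl⟩, ?_⟩
  rw [Set.iUnion_const]
  exact Set.eq_univ_of_forall fun y i hi => absurd hi i.not_lt_zero

theorem measurableSet_of_mem_rectangles {A : Set Space} (hA : A ∈ rectangles) :
    MeasurableSet A := by
  obtain ⟨E, hE, _, ⟨N, w, -, rfl⟩, rfl⟩ := hA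
  exact MeasurableSet.prod hE (measurableSet_cyl N w)

theorem fibreCov_rectangles {A B : Set Space} (hA : A ∈ rectangles) (hB : B ∈ rectangles) :
    ∀ᶠ k in atTop, ∀ x, fibreCov k A B x = 0 := by
  obtain ⟨E, -, _, ⟨N, w, -, rfl⟩, rfl⟩ := hA
  obtain ⟨F, -, _, ⟨M, v, -, rfl⟩, rfl⟩ := hB
  -- With `m = max N M`, both cylinders depend on fewer than `2 ^ m + 1` coordinates, so a delay of
  -- `3 ^ m` suffices for every `x` at once.
  have hpow : max N M ≤ 2 ^ max N M := Nat.lt_two_pow_self.le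
  have hC := (dependsBelow_cyl N w).mono ((le_max_left N M).trans hpow)
  have hD := (dependsBelow_cyl M v).mono ((le_max_right N M).trans hpow)
  filter_upwards [eventually_ge_atTop (3 ^ max N M)] with k hk x
  rw [fibreCov, preimage_mk_iterate]
  by_cases hx : x ∈ E
  · by_cases hx' : baseMap^[k] x ∈ F
    · rw [Set.mk_preimage_prod_right hx, Set.mk_preimage_prod_right hx', setCov, measureReal_def,
        fibreMeasure_inter_preimage_iterCocycle x hC hD hk, measureReal_def, measureReal_def,
        (measurePreserving_iterCocycle k x).measure_preimage hD.measurableSet.nullMeasurableSet,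
        ENNReal.toReal_mul, sub_self]
    · simp [Set.mk_preimage_prod_right_eq_empty hx', setCov]
  · simp [Set.mk_preimage_prod_right_eq_empty hx, setCov]

/-- The π-system principle is applied twice: to `B` with `A` a rectangle, then to `A` with `B`
arbitrary. -/
theorem tendsto_lintegral_fibreCov {A B : Set Space} (hA : MeasurableSet A)
    (hB : MeasurableSet B) :
    Tendsto (fun k => ∫⁻ x, ‖fibreCov k A B x‖ₑ ∂baseMeasure) atTop (nhds 0) := by
  have hmk : ∀ {A : Set Space} (x : Base), MeasurableSet A → MeasurableSet (Prod.mk x ⁻¹' A) :=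
    fun x hA => measurable_prodMk_left hA
  have hrect : ∀ {A B : Set Space}, A ∈ rectangles → MeasurableSet B →
      Tendsto (fun k => ∫⁻ x, ‖fibreCov k A B x‖ₑ ∂baseMeasure) atTop (nhds 0) := by
    intro A B hAr hB
    have hA := measurableSet_of_mem_rectangles hAr
    refine tendsto_zero_of_generateFrom (μ := skewMeasure)
      (a := fun k B => ∫⁻ x, ‖fibreCov k A B x‖ₑ ∂baseMeasure) generateFrom_rectangles
      isPiSystem_rectangles ?_ ?_ ?_ ?_ hB
    · intro k B hB
      -- The fibre bound integrates to the measure of the `k`-th preimage of `B`; invariance removes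
      -- `k` from it.
      rw [← (measurePreserving_skewMap.iterate k).measure_preimage hB.nullMeasurableSet,
        skewMeasure, Measure.prod_apply (measurableSet_preimage_iterate k hB)]
      exact lintegral_mono fun x => enorm_setCov_le _ _ _
    · intro k B hB
      refine lintegral_mono fun x => le_of_eq ?_
      rw [fibreCov, Set.preimage_compl, Set.preimage_compl,
        setCov_compl _ (hmk x hA) (hmk x (measurableSet_preimage_iterate k hB)), enorm_neg]
      rfl
    · intro k B D hB hD hBD
      rw [← lintegral_add_left (measurable_fibreCov k hA hB).enorm]
      refine lintegral_mono fun x => ?_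
      rw [fibreCov, Set.preimage_union, Set.preimage_union, setCov_union _ _ (hmk x hA)
        (hmk x (measurableSet_preimage_iterate k hD)) ((hBD.preimage _).preimage _)]
      exact enorm_add_le _ _
    · intro B hB
      refine tendsto_const_nhds.congr' ?_
      filter_upwards [fibreCov_rectangles hAr hB] with k hk
      simp [hk]
  refine tendsto_zero_of_generateFrom (μ := skewMeasure)
    (a := fun k A => ∫⁻ x, ‖fibreCov k A B x‖ₑ ∂baseMeasure) generateFrom_rectangles
    isPiSystem_rectangles ?_ ?_ ?_ (fun A hA => hrect hA hB) hA
  · intro k A hA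
    rw [skewMeasure, Measure.prod_apply hA]
    refine lintegral_mono fun x => ?_
    rw [fibreCov, setCov_comm]
    exact enorm_setCov_le _ _ _
  · intro k A hA
    refine lintegral_mono fun x => le_of_eq ?_
    rw [fibreCov, setCov_comm, Set.preimage_compl,
      setCov_compl _ (hmk x (measurableSet_preimage_iterate k hB)) (hmk x hA), enorm_neg,
      setCov_comm]
    rfl
  · intro k A D hA hD hAD
    rw [← lintegral_add_left (measurable_fibreCov k hA hB).enorm]
    refine lintegral_mono fun x => ?_
    rw [fibreCov, setCov_comm, Set.preimage_union, setCov_union _ _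
      (hmk x (measurableSet_preimage_iterate k hB)) (hmk x hD) (hAD.preimage _), setCov_comm,
      setCov_comm _ _ (Prod.mk x ⁻¹' D)]
    exact enorm_add_le _ _

theorem measurePreserving_fst_skewMeasure :
    MeasurePreserving (Prod.fst : Space → Base) skewMeasure baseMeasure :=
  measurePreserving_fst

theorem relTwofoldMixing_skewMap : RelTwofoldMixing skewMeasure skewMap baseFactor := by
  intro A B hA hB
  have hlim : TendstoInMeasure skewMeasure (fun (k : ℕ) (p : Space) => fibreCov k A B p.1) atTop
      (fun _ => (0 : ℝ)) := by
    refine tendstoInMeasure_of_tendsto_eLpNorm one_ne_zero (fun k =>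
      ((measurable_fibreCov k hA hB).comp measurable_fst).aestronglyMeasurable)
      aestronglyMeasurable_const ?_
    refine (tendsto_lintegral_fibreCov hA hB).congr fun k => ?_
    rw [eLpNorm_one_eq_lintegral_enorm]
    simp only [Pi.sub_apply, sub_zero]
    exact (measurePreserving_fst_skewMeasure.lintegral_comp
      (measurable_fibreCov k hA hB).enorm).symm
  refine hlim.congr' (Eventually.of_forall fun k => ?_) ae_eq_rfl
  have hB' := measurableSet_preimage_iterate k hB
  filter_upwards [condExp_ae_eq_fibreMass (hA.inter hB'), condExp_ae_eq_fibreMass hA,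
    condExp_ae_eq_fibreMass hB'] with p h1 h2 h3
  rw [h1, h2, h3, fibreCov_eq]

theorem fibreMass_baseMap {A : Set Space} (hA : MeasurableSet A) (hinv : skewMap ⁻¹' A = A)
    (x : Base) : fibreMass A (baseMap x) = fibreMass A x := by
  have h := preimage_mk_iterate 1 x A
  rw [Function.iterate_one, hinv] at h
  rw [fibreMass, fibreMass, h, measureReal_def, measureReal_def,
    (measurePreserving_iterCocycle 1 x).measure_preimage
      (measurable_prodMk_left hA).nullMeasurableSet]
  rfl

theorem ergodic_skewMap : Ergodic skewMap skewMeasure := by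
  refine ⟨measurePreserving_skewMap, ⟨fun A hA hinv => ?_⟩⟩
  have hiter : ∀ k, skewMap^[k] ⁻¹' A = A := by
    intro k
    induction k with
    | zero => rfl
    | succ k ih => rw [Function.iterate_succ, Set.preimage_comp, ih, hinv]
  have hcov : ∀ k x, fibreCov k A A x = fibreMass A x - fibreMass A x * fibreMass A x := by
    intro k x
    rw [fibreCov_eq, hiter, Set.inter_self]
  -- By invariance of `A` the correlation with itself does not depend on `k`, while it tends to `0`;
  -- so it vanishes, and almost every fibre mass solves `a = a * a`.
  have hzero : ∫⁻ x, ‖fibreCov 0 A A x‖ₑ ∂baseMeasure = 0 := by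
    refine tendsto_nhds_unique (tendsto_const_nhds.congr fun k => ?_)
      (tendsto_lintegral_fibreCov hA hA)
    simp only [hcov]
  rw [lintegral_eq_zero_iff (measurable_fibreCov 0 hA hA).enorm] at hzero
  have h01 : ∀ᵐ x ∂baseMeasure, fibreMass A x = 0 ∨ fibreMass A x = 1 := by
    filter_upwards [hzero] with x hx
    rw [Pi.zero_apply, enorm_eq_zero, hcov] at hx
    have : fibreMass A x * (1 - fibreMass A x) = 0 := by linarith
    rcases mul_eq_zero.1 this with h | h
    · exact Or.inl h
    · exact Or.inr (by linarith)
  have hE : MeasurableSet (fibreMass A ⁻¹' {1}) :=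
    measurable_fibreMass hA (measurableSet_singleton 1)
  have hEinv : baseMap ⁻¹' (fibreMass A ⁻¹' {1}) = fibreMass A ⁻¹' {1} := by
    ext x
    simp only [Set.mem_preimage, fibreMass_baseMap hA hinv]
  have hmass : ∀ x, fibreMeasure (Prod.mk x ⁻¹' A) = ENNReal.ofReal (fibreMass A x) := fun x =>
    (ENNReal.ofReal_toReal (measure_ne_top _ _)).symm
  have hconst := ergodic_baseMap.aeconst_set hE hEinv
  rw [eventuallyConst_set] at hconst
  rw [eventuallyConst_set', ae_eq_empty, ae_eq_univ, prob_compl_eq_zero_iff hA, skewMeasure,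
    Measure.prod_apply hA]
  rcases hconst with h | h
  · right
    rw [lintegral_congr_ae (g := fun _ => 1), lintegral_one, measure_univ]
    filter_upwards [h] with x hx
    have hx' : fibreMass A x = 1 := hx
    rw [hmass, hx', ENNReal.ofReal_one]
  · left
    rw [lintegral_congr_ae (g := fun _ => 0), lintegral_zero]
    filter_upwards [h, h01] with x hx hx'
    rw [hmass, hx'.resolve_right hx, ENNReal.ofReal_zero]

/-! ### The event that witnesses the failure of threefold mixing -/

theorem measurableSet_zeroCoordOne : MeasurableSet zeroCoordOne :=
  measurable_snd dependsBelow_firstCoordOne.measurableSet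

theorem preimage_mk_iterate_zeroCoordOne (k : ℕ) (x : Base) :
    Prod.mk x ⁻¹' (skewMap^[k] ⁻¹' zeroCoordOne) = iterCocycle k x ⁻¹' firstCoordOne :=
  preimage_mk_iterate k x zeroCoordOne

theorem condExp_zeroCoordOne (k : ℕ) : ∀ᵐ p ∂skewMeasure,
    (skewMeasure⟦skewMap^[k] ⁻¹' zeroCoordOne | baseFactor⟧) p = 1 / 2 := by
  filter_upwards [condExp_ae_eq_fibreMass
    (measurableSet_preimage_iterate k measurableSet_zeroCoordOne)] with p hp
  rw [hp, fibreMass, preimage_mk_iterate_zeroCoordOne, measureReal_def,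
    (measurePreserving_iterCocycle k p.1).measure_preimage
      dependsBelow_firstCoordOne.measurableSet.nullMeasurableSet, fibreMeasure_firstCoordOne]
  norm_num

theorem condExp_triple (n : ℕ) : ∀ᵐ p ∂skewMeasure, p.1 ∈ firstColumn n →
    (skewMeasure⟦zeroCoordOne ∩ skewMap^[3 ^ n] ⁻¹' zeroCoordOne ∩
      skewMap^[2 * 3 ^ n] ⁻¹' zeroCoordOne | baseFactor⟧) p = 1 / 4 := by
  filter_upwards [condExp_ae_eq_fibreMass ((measurableSet_zeroCoordOne.inter
    (measurableSet_preimage_iterate (3 ^ n) measurableSet_zeroCoordOne)).inter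
    (measurableSet_preimage_iterate (2 * 3 ^ n) measurableSet_zeroCoordOne))] with p hp hcol
  simp only [firstColumn, Set.mem_iUnion, Finset.mem_range, exists_prop] at hcol
  obtain ⟨i, hi, hx⟩ := hcol
  rw [hp, fibreMass, Set.preimage_inter, Set.preimage_inter, preimage_mk_iterate_zeroCoordOne,
    preimage_mk_iterate_zeroCoordOne, measureReal_def]
  have h := fibreMeasure_triple hi hx
  have h0 : Prod.mk p.1 ⁻¹' zeroCoordOne = firstCoordOne := rfl
  rw [h0, h, ENNReal.toReal_mul]
  norm_num

/-- This mass does not shrink with `n`, which is what excludes convergence in probability. -/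
theorem baseMeasure_firstColumn (n : ℕ) : baseMeasure (firstColumn n) = ENNReal.ofReal (1 / 3) := by
  have hlt : ∀ i ∈ Finset.range (3 ^ n), i < 3 ^ (n + 1) := fun i hi =>
    (Finset.mem_range.1 hi).trans_le (Nat.pow_le_pow_right (by norm_num) n.le_succ)
  rw [firstColumn, measure_biUnion_finset]
  · rw [Finset.sum_congr rfl fun i hi => baseMeasure_level (hlt i hi), Finset.sum_const,
      Finset.card_range, ← ENNReal.ofReal_nsmul, nsmul_eq_mul]
    congr 1
    push_cast
    rw [pow_succ, ← mul_assoc, ← mul_pow]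
    norm_num
  · intro i hi j hj hij
    exact Set.disjoint_left.2 fun x hx hx' => hij (level_inj (hlt i hi) (hlt j hj) hx hx')
  · exact fun i _ => measurableSet_level _ _

theorem not_relThreefoldMixing_skewMap :
    ¬ RelThreefoldMixing skewMeasure skewMap baseFactor := by
  intro h
  -- The threshold is `1/4 - 1/8`; convergence in measure concerns the set where the error is at
  -- least the threshold, so equality is enough.
  have h1 := h zeroCoordOne zeroCoordOne zeroCoordOne measurableSet_zeroCoordOne
    measurableSet_zeroCoordOne measurableSet_zeroCoordOne (ENNReal.ofReal (1 / 8)) (by simp)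
  have hpow : Tendsto (fun n : ℕ => 3 ^ n) atTop atTop :=
    tendsto_pow_atTop_atTop_of_one_lt (by norm_num)
  -- Both gaps are set to `3 ^ n`, so that the times are `0`, `3 ^ n`, `2 * 3 ^ n`.
  have h2 := h1.comp (hpow.prodMk hpow)
  have h3 : ENNReal.ofReal (1 / 3) ≤ 0 := by
    refine ge_of_tendsto h2 (Eventually.of_forall fun n => ?_)
    rw [← baseMeasure_firstColumn n]
    have hcol : MeasurableSet (firstColumn n) :=
      Finset.measurableSet_biUnion _ fun i _ => measurableSet_level _ _
    rw [← measurePreserving_fst_skewMeasure.measure_preimage hcol.nullMeasurableSet]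
    refine measure_mono_ae ?_
    filter_upwards [condExp_triple n, condExp_zeroCoordOne 0, condExp_zeroCoordOne (3 ^ n),
      condExp_zeroCoordOne (2 * 3 ^ n)] with p hp h0 hn h2n hpcol
    rw [Function.iterate_zero, Set.preimage_id] at h0
    change ENNReal.ofReal (1 / 8) ≤ edist _ (0 : ℝ)
    simp only [← two_mul]
    rw [hp hpcol, h0, hn, h2n, edist_dist]
    refine ENNReal.ofReal_le_ofReal ?_
    rw [Real.dist_eq]
    norm_num
  simp at h3

end TriadicSkew

end

open TriadicSkew in
theorem theorem1 :
    -- the base is an ergodic automorphism of a probability space, and `S_x` is an automorphism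
    (IsProbabilityMeasure baseMeasure ∧ IsAutomorphism baseMeasure baseMap ∧
      Ergodic baseMap baseMeasure) ∧
    (∀ x : Base, Function.Bijective (cocycle x) ∧ IsAutomorphism fibreMeasure (cocycle x)) ∧
    -- the skew product is an ergodic automorphism of a Lebesgue probability space with a factor
    (StandardBorelSpace Space ∧ IsProbabilityMeasure skewMeasure ∧ NullSingletonClass skewMeasure ∧
      IsAutomorphism skewMeasure skewMap ∧ Ergodic skewMap skewMeasure ∧
      IsFactor skewMap baseFactor) ∧
    RelTwofoldMixing skewMeasure skewMap baseFactor ∧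
    ¬ RelThreefoldMixing skewMeasure skewMap baseFactor ∧
    -- the failure of threefold mixing is witnessed by the event `y_0 = 1`
    (∀ k : ℕ, ∀ᵐ p ∂skewMeasure,
      (skewMeasure⟦skewMap^[k] ⁻¹' zeroCoordOne | baseFactor⟧) p = 1 / 2) ∧
    (∀ n : ℕ, 1 ≤ n → ∀ᵐ p ∂skewMeasure, p.1 ∈ firstColumn n →
      (skewMeasure⟦zeroCoordOne ∩ skewMap^[3 ^ n] ⁻¹' zeroCoordOne ∩
        skewMap^[2 * 3 ^ n] ⁻¹' zeroCoordOne | baseFactor⟧) p = 1 / 4) := by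
  refine ⟨⟨inferInstance, isAutomorphism_of_injective measurePreserving_baseMap baseMap_injective,
    ergodic_baseMap⟩, fun x => ⟨tauComp_bijective _, isAutomorphism_of_injective
      (measurePreserving_tauComp _) (tauComp_bijective _).1⟩,
    ⟨inferInstance, inferInstance, inferInstance,
      isAutomorphism_of_injective measurePreserving_skewMap skewMap_injective, ergodic_skewMap,
      isFactor_baseFactor⟩,
    relTwofoldMixing_skewMap, not_relThreefoldMixing_skewMap, condExp_zeroCoordOne,
    fun n _ => condExp_triple n⟩
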